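/- A \emph{colored graph} on a finite vertex set $V$ is a function $c:V^2\to C$ into a set of colors such that $c(v,v)\ne c(u,w)$ whenever $u\ne w$, and $c(u,v)=c(u',v')$ if and only if $c(v,u)=c(v',u')$. A \emph{vertex-colored graph} $G$ (a finite simple undirected graph with a coloring $c_G$ of its vertices) is regarded as a colored graph in which the color of the loop $vv$ is the color of $v$, and two further colors mark the adjacent and the non-adjacent pairs of distinct vertices. The \emph{color multiplicity} of $G$ is the maximum number of equally colored vertices. Isomorphisms are bijections of the vertex sets that preserve all colors (hence also adjacency). The 2-dimensional Weisfeiler--Leman algorithm (2-WL) computes colorings of $V^2$ by $c^0=c$ and $$c^{i+1}(u,v)=\bigl(c^i(u,v),\ \{\!\{(c^i(u,w),c^i(w,v)) : w\in V\}\!\}\bigr).$$ Colored graphs $G,H$ are \emph{2-WL-equivalent}, $G\equiv H$, if for every $i$ the multisets $\{\!\{c^i_G(u,v):(u,v)\in V(G)^2\}\!\}$ and $\{\!\{c^i_H(u,v):(u,v)\in V(H)^2\}\!\}$ are equal. A colored graph $G$ is \emph{amenable} (to 2-WL) if every colored graph $H$ with $G\equiv H$ is isomorphic to $G$. \textbf{Theorem.}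 \begin{enumerate} \item Every vertex-colored graph of color multiplicity $4$ with at most $15$ vertices is amenable. \item Up to isomorphism and color renaming, there are exactly $436$ non-amenable vertex-colored graphs of color multiplicity $4$ with $16$ vertices. More precisely, call the $\equiv$-class of a vertex-colored graph non-trivial if it contains two non-isomorphic graphs. Up to color renaming, the number of non-trivial $\equiv$-classes of vertex-colored graphs of color multiplicity $4$ with $16$ vertices is $218$. Each such class consists of exactly two graphs up to isomorphism, and together with all its color renamings it consists of exactly two graphs up to isomorphism and color renaming. \end{enumerate} Here the vertex colors are taken from an arbitrary fixed set with at least four elements, and a color renaming is a permutation of this set. -/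

import Mathlib

universe u v

/-- A colored (directed) graph: every ordered pair of vertices, loops included, carries a color;
loops and non-loops never share a color, and equally colored arrows have equally colored
inverses. -/
structure ColoredGraph (V : Type u) (C : Type v) where
  col : V → V → C
  loop_ne : ∀ v u w, u ≠ w → col v v ≠ col u w
  transpose : ∀ u v u' v', col u v = col u' v' ↔ col v u = col v' u'

/-- The colors that may occur after `i` rounds of refinement over the initial color set `C`. A new
color is the old color together with a multiset of pairs of old colors. -/
def WLColor (C : Type v) : ℕ → Type v
  | 0 => C
  | i + 1 => WLColor C i × Multiset (WLColor C i × WLColor C i)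

namespace ColoredGraph

variable {V W : Type u} {C : Type v}

/-- Isomorphism of colored graphs: a bijection of the vertices that preserves all colors. -/
def Isomorphic (G : ColoredGraph V C) (H : ColoredGraph W C) : Prop :=
  ∃ φ : V ≃ W, ∀ u v, H.col (φ u) (φ v) = G.col u v

/-- The coloring of the pairs of vertices after `i` rounds of the 2-dimensional Weisfeiler-Leman
algorithm: the new color of `(u, v)` is its old color together with the multiset, over all
vertices `w`, of the pairs (old color of `(u, w)`, old color of `(w, v)`). -/
def wl [Fintype V] (G : ColoredGraph V C) : (i : ℕ) → V → V → WLColor C i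
  | 0 => G.col
  | i + 1 => fun u v => (wl G i u v, Finset.univ.val.map fun w => (wl G i u w, wl G i w v))

/-- 2-WL-equivalence: in every round, the multisets of the colors of all pairs agree.
(As round `i + 1` refines round `i` and both colorings stop being refined together, this is the
same as agreement in the round in which the algorithm stops.) -/
def WLEquiv [Fintype V] [Fintype W] (G : ColoredGraph V C) (H : ColoredGraph W C) : Prop :=
  ∀ i : ℕ, (Finset.univ : Finset (V × V)).val.map (fun p => G.wl i p.1 p.2) =
    (Finset.univ : Finset (W × W)).val.map (fun p => H.wl i p.1 p.2)

/-- Amenability to 2-WL: every 2-WL-equivalent finite colored graph is isomorphic. -/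
def Amenable [Fintype V] (G : ColoredGraph V C) : Prop :=
  ∀ (W : Type u) [Fintype W] (H : ColoredGraph W C), G.WLEquiv H → G.Isomorphic H

end ColoredGraph

/-- A vertex-colored graph: a simple undirected graph with a coloring of its vertices. -/
structure VertexColoredGraph (V : Type u) (C : Type v) where
  graph : SimpleGraph V
  color : V → C

/-- The colors of pairs of vertices of a vertex-colored graph. -/
inductive PairColor (C : Type v) where
  | loop (c : C) : PairColor C
  | edge : PairColor C
  | nonedge : PairColor C

namespace PairColor

/-- The effect on pair colors of renaming the vertex colors. -/
def map {C : Type v} (σ : C → C) : PairColor C → PairColor C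
  | loop c => loop (σ c)
  | edge => edge
  | nonedge => nonedge

end PairColor

namespace VertexColoredGraph

variable {V W : Type u} {C : Type v}

open Classical in
/-- A vertex-colored graph as a colored graph: loops have the color of their vertex, and there are
two further colors for adjacent and for non-adjacent pairs of distinct vertices. -/
noncomputable def toColoredGraph (G : VertexColoredGraph V C) : ColoredGraph V (PairColor C) where
  col u v := if u = v then .loop (G.color u) else if G.graph.Adj u v then .edge else .nonedge
  loop_ne v u w h := by
    by_cases h' : G.graph.Adj u w <;> simp [h, h']
  transpose u v u' v' := by
    by_cases h : u = v
    · subst h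
      by_cases h' : u' = v'
      · subst h'; simp
      · by_cases h1 : G.graph.Adj u' v' <;>
          simp [h', Ne.symm h', h1, G.graph.adj_comm v' u']
    · rw [G.graph.adj_comm v u, G.graph.adj_comm v' u', if_neg h, if_neg (Ne.symm h)]
      by_cases h' : u' = v'
      · subst h'; simp
      · rw [if_neg h', if_neg (Ne.symm h')]

/-- The color multiplicity: the maximum number of equally colored vertices. -/
noncomputable def colorMultiplicity [Fintype V] (G : VertexColoredGraph V C) : ℕ :=
  Finset.univ.sup fun v : V => Set.ncard {w : V | G.color w = G.color v}

/-- Isomorphism of vertex-colored graphs: a graph isomorphism that preserves the colors. -/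
def Isomorphic (G : VertexColoredGraph V C) (H : VertexColoredGraph W C) : Prop :=
  ∃ φ : G.graph ≃g H.graph, ∀ v, H.color (φ v) = G.color v

/-- 2-WL-equivalence of vertex-colored graphs. -/
def WLEquiv [Fintype V] [Fintype W] (G : VertexColoredGraph V C) (H : VertexColoredGraph W C) :
    Prop :=
  G.toColoredGraph.WLEquiv H.toColoredGraph

/-- Amenability to 2-WL of vertex-colored graphs. -/
def Amenable [Fintype V] (G : VertexColoredGraph V C) : Prop :=
  G.toColoredGraph.Amenable

/-- Renaming the colors. -/
def rename (σ : Equiv.Perm C) (G : VertexColoredGraph V C) : VertexColoredGraph V C where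
  graph := G.graph
  color v := σ (G.color v)

theorem Isomorphic.rename {G H : VertexColoredGraph V C} (h : G.Isomorphic H)
    (σ : Equiv.Perm C) : (G.rename σ).Isomorphic (H.rename σ) := by
  obtain ⟨φ, hφ⟩ := h
  exact ⟨φ, fun v => congrArg σ (hφ v)⟩

theorem Isomorphic.symm {G H : VertexColoredGraph V C} (h : G.Isomorphic H) :
    H.Isomorphic G := by
  obtain ⟨φ, hφ⟩ := h
  exact ⟨φ.symm, fun v => by rw [← hφ, RelIso.apply_symm_apply]⟩

theorem Isomorphic.trans {G H K : VertexColoredGraph V C} (h : G.Isomorphic H)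
    (h' : H.Isomorphic K) : G.Isomorphic K := by
  obtain ⟨φ, hφ⟩ := h
  obtain ⟨ψ, hψ⟩ := h'
  exact ⟨φ.trans ψ, fun v => (hψ (φ v)).trans (hφ v)⟩

/-- The action of a renaming of the initial colors on the colors after `i` rounds. -/
def wlColorMap {D : Type v} (f : D → D) : (i : ℕ) → WLColor D i → WLColor D i
  | 0 => f
  | i + 1 => Prod.map (wlColorMap f i) (Multiset.map (Prod.map (wlColorMap f i) (wlColorMap f i)))

theorem wl_rename [Fintype V] (G : VertexColoredGraph V C) (σ : Equiv.Perm C) (i : ℕ) (u v : V) :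
    (G.rename σ).toColoredGraph.wl i u v =
      wlColorMap (PairColor.map σ) i (G.toColoredGraph.wl i u v) := by
  induction i generalizing u v with
  | zero =>
    by_cases h : u = v <;> by_cases h' : G.graph.Adj u v <;>
      simp [ColoredGraph.wl, wlColorMap, toColoredGraph, VertexColoredGraph.rename, PairColor.map,
        h, h'] <;> rfl
  | succ i ih =>
    simp only [ColoredGraph.wl, ih]
    refine Prod.ext rfl ?_
    change _ = Multiset.map _ (Multiset.map _ _)
    rw [Multiset.map_map]
    rfl

theorem WLEquiv.rename [Fintype V] {G H : VertexColoredGraph V C} (h : G.WLEquiv H)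
    (σ : Equiv.Perm C) : (G.rename σ).WLEquiv (H.rename σ) := by
  intro i
  have := congrArg (Multiset.map (wlColorMap (PairColor.map σ) i)) (h i)
  simpa only [wl_rename, Multiset.map_map, Function.comp_def] using this

/-- Isomorphism classes. -/
def isoSetoid (V : Type u) (C : Type v) : Setoid (VertexColoredGraph V C) where
  r G H := G.Isomorphic H
  iseqv := ⟨fun _ => ⟨SimpleGraph.Iso.refl, fun _ => rfl⟩, fun h => h.symm, fun h h' => h.trans h'⟩

/-- Isomorphism up to color renaming. -/
def isoRenameSetoid (V : Type u) (C : Type v) : Setoid (VertexColoredGraph V C) where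
  r G H := ∃ σ : Equiv.Perm C, (G.rename σ).Isomorphic H
  iseqv := by
    refine ⟨fun _ => ⟨1, SimpleGraph.Iso.refl, fun _ => rfl⟩, ?_, ?_⟩
    · rintro G H ⟨σ, h⟩
      refine ⟨σ⁻¹, ?_⟩
      simpa [VertexColoredGraph.rename] using (h.rename σ⁻¹).symm
    · rintro G H K ⟨σ, h⟩ ⟨τ, h'⟩
      exact ⟨τ * σ, (h.rename τ).trans h'⟩

/-- 2-WL-equivalence up to color renaming. -/
def wlRenameSetoid (V : Type u) (C : Type v) [Fintype V] : Setoid (VertexColoredGraph V C) where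
  r G H := ∃ σ : Equiv.Perm C, (G.rename σ).WLEquiv H
  iseqv := by
    refine ⟨fun _ => ⟨1, fun _ => rfl⟩, ?_, ?_⟩
    · rintro G H ⟨σ, h⟩
      refine ⟨σ⁻¹, fun i => ?_⟩
      simpa [VertexColoredGraph.rename] using (h.rename σ⁻¹ i).symm
    · rintro G H K ⟨σ, h⟩ ⟨τ, h'⟩
      exact ⟨τ * σ, fun i => (h.rename τ i).trans (h' i)⟩

/-- The 2-WL-equivalence class of `G` is non-trivial: it contains a graph not isomorphic
to `G`. -/
def HasNontrivialWLClass [Fintype V] (G : VertexColoredGraph V C) : Prop :=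
  ∃ H : VertexColoredGraph V C, G.WLEquiv H ∧ ¬ G.Isomorphic H

end VertexColoredGraph

/-! Suppose a colored graph is 2-WL-equivalent to `G`. The stable pair types of the two are matched
as in `WLSim`, and the vertices of `G` split by loop type into fibers of size at most 4. Any three
vertices can be matched type-preservingly, and a partial match always grows inside a fiber with at
most three uncovered vertices, because a partition of at most three points is trivial or has a
singleton class (`exists_extend_fiber`). So a failure of isomorphism needs four fibers of size 4,
hence 16 vertices. A fourth vertex can be matched too, unless the class of a vertex as seen from one
fiber is never contained in its class as seen from another. Then the other three fibers split each
fiber into pairs in the three possible ways, which are the parallel classes of the affine plane over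
two elements.

Indexing fibers, and vertices inside a fiber, by the Klein four-group turns `G` into a
Cai-Fürer-Immerman graph over the complete graph on four vertices (`exists_eq_twisted`). Fibers `i`
and `j` are joined according to the value of `form (i + j)`, up to a twist. Inside fiber `i` the
matching in direction `i + j` is present or absent, and these choices form a loopless digraph on the
four fibers.

Conversely, translating fibers reduces all twists to one bit (`exists_normalize`). 2-WL cannot see
the bit, since a twisted edge can be moved away from the at most three fibers inspected at once
(`wl_twisted_single`). Isomorphism sees it, through the existence of a rainbow clique
(`hasRainbowClique_twisted`). The digraph is recovered by 2-WL (`digraph_of_wlEquiv`), and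
isomorphic digraphs give isomorphic graphs up to renaming because every permutation of the Klein
group is affine (`form_perm`). The graphs thus correspond to pairs of a digraph class and a bit, and
the 218 digraph classes give 218 · 2 = 436. -/

theorem exists_equiv_of_map_univ_eq {α β γ : Type*} [Fintype α] [Fintype β] {f : α → γ}
    {g : β → γ} (h : (Finset.univ : Finset α).val.map f = (Finset.univ : Finset β).val.map g) :
    ∃ e : α ≃ β, ∀ a, g (e a) = f a := by
  classical
  have key : ∀ c, Nonempty ({a // f a = c} ≃ {b // g b = c}) := by
    intro c
    rw [← Fintype.card_eq, Fintype.card_subtype, Fintype.card_subtype]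
    have h' := congrArg (Multiset.count c) h
    rw [Multiset.count_map, Multiset.count_map] at h'
    simpa [Finset.card_def, Finset.filter_val, eq_comm] using h'
  exact ⟨Equiv.ofFiberEquiv fun c => (key c).some, fun a => Equiv.ofFiberEquiv_map _ a⟩

theorem map_univ_eq_of_equiv {α β γ : Type*} [Fintype α] [Fintype β] {f : α → γ}
    {g : β → γ} (e : α ≃ β) (h : ∀ a, g (e a) = f a) :
    (Finset.univ : Finset α).val.map f = (Finset.univ : Finset β).val.map g := by
  rw [← Multiset.map_univ_val_equiv e, Multiset.map_map]
  exact Multiset.map_congr rfl fun a _ => (h a).symm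

/-! ### Stable pair types of 2-WL-equivalent graphs -/

/-- Two colorings of pairs that behave like the stable colorings of two 2-WL-equivalent colored
graphs. -/
structure WLSim {V : Type*} {W : Type*} {T : Type*} (τ : V → V → T) (τ' : W → W → T) : Prop where
  exists_equiv : ∀ {u v u' v'}, τ u v = τ' u' v' →
    ∃ β : V ≃ W, ∀ w, τ' u' (β w) = τ u w ∧ τ' (β w) v' = τ w v
  exists_image : ∀ u v, ∃ u' v', τ u v = τ' u' v'
  exists_preimage : ∀ u' v', ∃ u v, τ u v = τ' u' v'
  loop : ∀ {u v u' v'}, τ u v = τ' u' v' → (u = v ↔ u' = v')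
  transpose : ∀ {u v u' v'}, τ u v = τ' u' v' → τ v u = τ' v' u'

namespace ColoredGraph

variable {V W : Type u} {C : Type v} [Fintype V] [Fintype W]

/-- The sequence of all colors of a pair of vertices during the refinement. -/
def wlType (G : ColoredGraph V C) (u v : V) (i : ℕ) : WLColor C i := G.wl i u v

theorem wl_eq_of_le {G : ColoredGraph V C} {H : ColoredGraph W C} {u v : V} {u' v' : W} {i j : ℕ}
    (hij : i ≤ j) (h : G.wl j u v = H.wl j u' v') : G.wl i u v = H.wl i u' v' := by
  induction hij with
  | refl => exact h
  | step _ ih => exact ih (congrArg Prod.fst h)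

/-- Each of the finitely many combinations with different color sequences is separated in some
round; the maximum of these rounds decides all of them. -/
theorem exists_round (G : ColoredGraph V C) (H : ColoredGraph W C) :
    ∃ N, ∀ u v u' v', G.wl N u v = H.wl N u' v' → G.wlType u v = H.wlType u' v' := by
  classical
  have key : ∀ p : (V × V) × (W × W), ∃ n, G.wl n p.1.1 p.1.2 = H.wl n p.2.1 p.2.2 →
      G.wlType p.1.1 p.1.2 = H.wlType p.2.1 p.2.2 := by
    intro p
    by_cases h : G.wlType p.1.1 p.1.2 = H.wlType p.2.1 p.2.2
    · exact ⟨0, fun _ => h⟩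
    · obtain ⟨n, hn⟩ := Function.ne_iff.mp h
      exact ⟨n, fun h' => absurd h' hn⟩
  choose n hn using key
  refine ⟨Finset.univ.sup n, fun u v u' v' h => hn ((u, v), (u', v')) ?_⟩
  exact wl_eq_of_le (Finset.le_sup (f := n) (Finset.mem_univ _)) h

theorem exists_equiv_of_wlType_eq {G : ColoredGraph V C} {H : ColoredGraph W C} {u v : V}
    {u' v' : W} (h : G.wlType u v = H.wlType u' v') :
    ∃ β : V ≃ W, ∀ w, H.wlType u' (β w) = G.wlType u w ∧ H.wlType (β w) v' = G.wlType w v := by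
  obtain ⟨N, hN⟩ := exists_round G H
  -- Round `N + 1` matches the vertices by their round-`N` colors, and these determine the whole
  -- color sequences.
  obtain ⟨β, hβ⟩ := exists_equiv_of_map_univ_eq (congrArg Prod.snd (congrFun h (N + 1)))
  refine ⟨β, fun w => ⟨(hN _ _ _ _ ?_).symm, (hN _ _ _ _ ?_).symm⟩⟩
  · exact (congrArg Prod.fst (hβ w)).symm
  · exact (congrArg Prod.snd (hβ w)).symm

theorem wl_transpose (G : ColoredGraph V C) (i : ℕ) {u v u' v' : V}
    (h : G.wl i u v = G.wl i u' v') : G.wl i v u = G.wl i v' u' := by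
  induction i generalizing u v u' v' with
  | zero => exact (G.transpose u v u' v').mp h
  | succ i ih =>
    obtain ⟨β, hβ⟩ := exists_equiv_of_map_univ_eq (congrArg Prod.snd h)
    refine Prod.ext (ih (congrArg Prod.fst h)) (map_univ_eq_of_equiv β fun w => ?_)
    exact Prod.ext (ih (congrArg Prod.snd (hβ w))) (ih (congrArg Prod.fst (hβ w)))

theorem wlType_transpose (G : ColoredGraph V C) {u v u' v' : V}
    (h : G.wlType u v = G.wlType u' v') : G.wlType v u = G.wlType v' u' :=
  funext fun i => G.wl_transpose i (congrFun h i)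

theorem eq_of_wlType_eq_loop (G : ColoredGraph V C) {u v w : V}
    (h : G.wlType u u = G.wlType v w) : v = w := by
  by_contra hne
  exact G.loop_ne u v w hne (congrFun h 0)

/-- `loop_ne` compares pairs of one graph only, so a loop of `G` might initially share its color
with a non-loop of `H`. Pulling the loop at `u'` back along the matching of third vertices excludes
this. -/
theorem eq_of_wlType_loop_eq {G : ColoredGraph V C} {H : ColoredGraph W C} {u : V} {u' v' : W}
    (h : G.wlType u u = H.wlType u' v') : u' = v' := by
  obtain ⟨β, hβ⟩ := exists_equiv_of_wlType_eq h
  obtain ⟨h1, h2⟩ := hβ (β.symm u')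
  rw [Equiv.apply_symm_apply] at h1 h2
  have h3 := G.eq_of_wlType_eq_loop (h.trans h2)
  rw [h3, h] at h1
  exact H.eq_of_wlType_eq_loop h1

theorem WLEquiv.symm {G : ColoredGraph V C} {H : ColoredGraph W C} (h : G.WLEquiv H) :
    H.WLEquiv G := fun i => (h i).symm

theorem WLEquiv.wlSim {G : ColoredGraph V C} {H : ColoredGraph W C} (h : G.WLEquiv H) :
    WLSim G.wlType H.wlType where
  exists_equiv := exists_equiv_of_wlType_eq
  exists_image u v := by
    obtain ⟨N, hN⟩ := exists_round G H
    obtain ⟨e, he⟩ := exists_equiv_of_map_univ_eq (h N)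
    exact ⟨_, _, hN _ _ _ _ (he (u, v)).symm⟩
  exists_preimage u v := by
    obtain ⟨N, hN⟩ := exists_round H G
    obtain ⟨e, he⟩ := exists_equiv_of_map_univ_eq (h N).symm
    exact ⟨_, _, (hN _ _ _ _ (he (u, v)).symm).symm⟩
  loop := by
    intro u v u' v' huv
    constructor
    · rintro rfl
      exact eq_of_wlType_loop_eq huv
    · rintro rfl
      exact eq_of_wlType_loop_eq huv.symm
  transpose := by
    intro u v u' v' huv
    -- Transposition, too, is only available within one graph. Matching the loops at `u` and `u'`
    -- first yields a vertex `β₂ v` whose pairs with `u'` have the right types in both directions;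
    -- it is compared with `v'` inside `H`.
    obtain ⟨β, hβ⟩ := exists_equiv_of_wlType_eq huv
    have h1 : β u = u' := ((eq_of_wlType_loop_eq (hβ u).1.symm)).symm
    obtain ⟨β₂, hβ₂⟩ := exists_equiv_of_wlType_eq (h1 ▸ (hβ u).1).symm
    exact (hβ₂ v).2.symm.trans (H.wlType_transpose ((hβ₂ v).1.trans huv))

end ColoredGraph

namespace WLSim

variable {V W T : Type*} {τ : V → V → T} {τ' : W → W → T}

theorem symm (h : WLSim τ τ') : WLSim τ' τ where
  exists_equiv huv := by
    obtain ⟨β, hβ⟩ := h.exists_equiv huv.symm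
    refine ⟨β.symm, fun w => ?_⟩
    obtain ⟨h1, h2⟩ := hβ (β.symm w)
    rw [Equiv.apply_symm_apply] at h1 h2
    exact ⟨h1.symm, h2.symm⟩
  exists_image u v := by
    obtain ⟨a, b, hab⟩ := h.exists_preimage u v
    exact ⟨a, b, hab.symm⟩
  exists_preimage u v := by
    obtain ⟨a, b, hab⟩ := h.exists_image u v
    exact ⟨a, b, hab.symm⟩
  loop huv := (h.loop huv.symm).symm
  transpose huv := (h.transpose huv.symm).symm

theorem self (h : WLSim τ τ') : WLSim τ τ where
  exists_equiv {u v u' v'} huv := by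
    obtain ⟨a, b, hab⟩ := h.exists_image u v
    obtain ⟨β, hβ⟩ := h.exists_equiv hab
    obtain ⟨γ, hγ⟩ := h.exists_equiv (huv.symm.trans hab)
    refine ⟨β.trans γ.symm, fun w => ?_⟩
    obtain ⟨h1, h2⟩ := hγ (γ.symm (β w))
    rw [Equiv.apply_symm_apply] at h1 h2
    exact ⟨h1.symm.trans (hβ w).1, h2.symm.trans (hβ w).2⟩
  exists_image u v := ⟨u, v, rfl⟩
  exists_preimage u v := ⟨u, v, rfl⟩
  loop {u v u' v'} huv := by
    obtain ⟨a, b, hab⟩ := h.exists_image u v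
    exact (h.loop hab).trans (h.loop (huv.symm.trans hab)).symm
  transpose {u v u' v'} huv := by
    obtain ⟨a, b, hab⟩ := h.exists_image u v
    exact (h.transpose hab).trans (h.transpose (huv.symm.trans hab)).symm

theorem left (h : WLSim τ τ') {u v : V} {u' v' : W} (e : τ u v = τ' u' v') :
    τ u u = τ' u' u' := by
  obtain ⟨β, hβ⟩ := h.exists_equiv e
  obtain ⟨h1, -⟩ := hβ u
  have := (h.loop h1.symm).mp rfl
  rw [← this] at h1
  exact h1.symm

theorem right (h : WLSim τ τ') {u v : V} {u' v' : W} (e : τ u v = τ' u' v') :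
    τ v v = τ' v' v' :=
  h.left (h.transpose e)

theorem exists_vertex (h : WLSim τ τ') (u : V) : ∃ u', τ u u = τ' u' u' := by
  obtain ⟨a, b, hab⟩ := h.exists_image u u
  obtain rfl := (h.loop hab).mp rfl
  exact ⟨a, hab⟩

theorem exists_third (h : WLSim τ τ') {u v : V} {u' v' : W} (e : τ u v = τ' u' v') (w : V) :
    ∃ w', τ u w = τ' u' w' ∧ τ w v = τ' w' v' := by
  obtain ⟨β, hβ⟩ := h.exists_equiv e
  exact ⟨β w, (hβ w).1.symm, (hβ w).2.symm⟩

theorem exists_pair (h : WLSim τ τ') {u : V} {u' : W} (e : τ u u = τ' u' u') (w : V) :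
    ∃ w', τ u w = τ' u' w' := by
  obtain ⟨w', h1, -⟩ := h.exists_third e w
  exact ⟨w', h1⟩

end WLSim

/-! ### Partial isomorphisms and their extension -/

/-- The map `f` preserves the types of all pairs from `S`. -/
def PreservesOn {V W T : Type*} (τ : V → V → T) (τ' : W → W → T) (f : V → W) (S : Finset V) :
    Prop :=
  ∀ u ∈ S, ∀ v ∈ S, τ u v = τ' (f u) (f v)

theorem WLSim.injOn {V W T : Type*} {τ : V → V → T} {τ' : W → W → T} (h : WLSim τ τ') {f : V → W}
    {S : Finset V} (hf : PreservesOn τ τ' f S) : Set.InjOn f S := fun u hu v hv huv =>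
  (h.loop (hf u hu v hv)).mpr huv

/-- A function on a set of at most three elements is constant or has a singleton fiber. -/
theorem Finset.exists_isolated {α β : Type*} {R : Finset α} (hR : R.card ≤ 3) {f : α → β}
    {a b : α} (ha : a ∈ R) (hb : b ∈ R) (hab : f a ≠ f b) :
    ∃ c ∈ R, ∀ w ∈ R, f w = f c → w = c := by
  classical
  by_contra hcon
  push Not at hcon
  obtain ⟨a', ha', h1, h2⟩ := hcon a ha
  obtain ⟨b', hb', h3, h4⟩ := hcon b hb
  have : ({a, a', b, b'} : Finset α) ⊆ R := by
    intro w
    simp only [Finset.mem_insert, Finset.mem_singleton]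
    rintro (rfl | rfl | rfl | rfl) <;> assumption
  have hc := Finset.card_le_card this
  rw [Finset.card_insert_of_notMem, Finset.card_insert_of_notMem, Finset.card_pair] at hc
  · omega
  · exact fun e => h4 e.symm
  · simp only [Finset.mem_insert, Finset.mem_singleton, not_or]
    exact ⟨fun e => hab (by rw [← h1, e]), fun e => hab (by rw [← h1, e, h3])⟩
  · simp only [Finset.mem_insert, Finset.mem_singleton, not_or]
    exact ⟨fun e => h2 e.symm, fun e => hab (by rw [e]), fun e => hab (by rw [e, h3])⟩

theorem Finset.card_filter_univ_eq_add {X : Type*} [Fintype X] [DecidableEq X] (A : Finset X)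
    (P : X → Prop) [DecidablePred P] :
    (Finset.univ.filter P).card = (A.filter P).card +
      (Finset.univ.filter fun w => w ∉ A ∧ P w).card := by
  rw [← Finset.card_union_of_disjoint]
  · congr 1
    ext w
    simp only [Finset.mem_filter, Finset.mem_union, Finset.mem_univ, true_and]
    tauto
  · rw [Finset.disjoint_left]
    intro w hw hw'
    simp only [Finset.mem_filter, Finset.mem_univ, true_and] at hw hw'
    exact hw'.1 hw.1

namespace WLSim

variable {V W T : Type*} [Fintype V] [Fintype W] [DecidableEq V] [DecidableEq W] [DecidableEq T]
  {τ : V → V → T} {τ' : W → W → T}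

/-- The counts over all vertices agree, and `f` matches the contributions of `S` and its image, so
these can be subtracted. -/
theorem card_compl (h : WLSim τ τ') {f : V → W} {S : Finset V} (hf : PreservesOn τ τ' f S)
    {x y : V} (hx : x ∈ S) (hy : y ∈ S) (s t : T) :
    (Finset.univ.filter fun w => w ∉ S ∧ τ x w = s ∧ τ w y = t).card =
      (Finset.univ.filter fun w => w ∉ S.image f ∧ τ' (f x) w = s ∧ τ' w (f y) = t).card := by
  obtain ⟨β, hβ⟩ := h.exists_equiv (hf x hx y hy)
  have h1 : (Finset.univ.filter fun w => τ x w = s ∧ τ w y = t).card =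
      (Finset.univ.filter fun w => τ' (f x) w = s ∧ τ' w (f y) = t).card := by
    refine Finset.card_equiv β fun w => ?_
    simp [hβ]
  have h2 : (S.filter fun w => τ x w = s ∧ τ w y = t).card =
      ((S.image f).filter fun w => τ' (f x) w = s ∧ τ' w (f y) = t).card := by
    rw [Finset.filter_image, Finset.card_image_of_injOn]
    · congr 1
      refine Finset.filter_congr fun w hw => ?_
      rw [hf x hx w hw, hf w hw y hy]
    · exact (h.injOn hf).mono (by simp [Set.subset_def]; tauto)
  rw [Finset.card_filter_univ_eq_add S, h2, Finset.card_filter_univ_eq_add (S.image f)] at h1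
  exact Nat.add_left_cancel h1

/-- By `hdom`, the type from `x` alone fixes the types from all of `S` to a new vertex. Equal counts
carry this over to the other side: the candidates right for `x` and `y` are as many as those right
for `x`, so every candidate for `x` suits all `y` simultaneously. -/
theorem exists_extend (h : WLSim τ τ') {f : V → W} {S : Finset V}
    (hf : PreservesOn τ τ' f S)
    {x b : V} (hx : x ∈ S) (hb : b ∉ S)
    (hdom : ∀ y ∈ S, ∀ w ∉ S, τ x w = τ x b → τ y w = τ y b) :
    ∃ f' : V → W, PreservesOn τ τ' f' (insert b S) ∧ ∀ y ∈ S, f' y = f y := by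
  have hT : ∀ {u v u' v'}, τ u v = τ u' v' → τ v u = τ v' u' := h.self.transpose
  set P' := Finset.univ.filter fun w => w ∉ S.image f ∧ τ' (f x) w = τ x b ∧ τ' w (f x) = τ b x
  have hP' := h.card_compl hf hx hx (τ x b) (τ b x)
  have hpos : 0 < P'.card := by
    rw [← hP', Finset.card_pos]
    exact ⟨b, by simp [hb]⟩
  obtain ⟨b', hb'⟩ := Finset.card_pos.mp hpos
  have hall : ∀ y ∈ S, τ b y = τ' b' (f y) := by
    intro y hy
    have hQ' := h.card_compl hf hx hy (τ x b) (τ b y)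
    have e : (Finset.univ.filter fun w => w ∉ S ∧ τ x w = τ x b ∧ τ w x = τ b x) =
        Finset.univ.filter fun w => w ∉ S ∧ τ x w = τ x b ∧ τ w y = τ b y := by
      refine Finset.filter_congr fun w _ => ?_
      constructor
      · rintro ⟨h1, h2, -⟩
        exact ⟨h1, h2, hT (hdom y hy w h1 h2)⟩
      · rintro ⟨h1, h2, -⟩
        exact ⟨h1, h2, hT h2⟩
    rw [← e, hP'] at hQ'
    have hsub : (Finset.univ.filter fun w =>
        w ∉ S.image f ∧ τ' (f x) w = τ x b ∧ τ' w (f y) = τ b y) ⊆ P' := by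
      intro w hw
      simp only [Finset.mem_filter, Finset.mem_univ, true_and, P'] at hw ⊢
      exact ⟨hw.1, hw.2.1, (h.transpose hw.2.1.symm).symm⟩
    have := Finset.eq_of_subset_of_card_le hsub hQ'.le
    rw [← this] at hb'
    simp only [Finset.mem_filter, Finset.mem_univ, true_and] at hb'
    exact hb'.2.2.symm
  refine ⟨Function.update f b b', ?_, ?_⟩
  · intro u hu v hv
    have hne : ∀ y ∈ S, y ≠ b := fun y hy e => hb (e ▸ hy)
    rcases Finset.mem_insert.mp hu with e | hu <;> rcases Finset.mem_insert.mp hv with e' | hv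
    · rw [e, e', Function.update_self]
      exact h.left (hall x hx)
    · rw [e, Function.update_self, Function.update_of_ne (hne v hv)]
      exact hall v hv
    · rw [e', Function.update_self, Function.update_of_ne (hne u hu)]
      exact h.transpose (hall u hu)
    · rw [Function.update_of_ne (hne v hv), Function.update_of_ne (hne u hu)]
      exact hf u hu v hv
  · intro y hy
    exact Function.update_of_ne (fun e => hb (by rw [← e]; exact hy)) _ _

/-- If some `x ∈ S` splits the at most three remaining vertices, one of them is alone in its class
and satisfies the domination condition trivially. Otherwise every vertex of `S` sees them all alike.
-/
theorem exists_extend_fiber (h : WLSim τ τ') {f : V → W}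
    {S : Finset V} (hf : PreservesOn τ τ' f S) (hS : S.Nonempty) {u : V} (hu : u ∉ S)
    (hcard : (Finset.univ.filter fun w => w ∉ S ∧ τ w w = τ u u).card ≤ 3) :
    ∃ b ∉ S, τ b b = τ u u ∧
      ∃ f' : V → W, PreservesOn τ τ' f' (insert b S) ∧ ∀ y ∈ S, f' y = f y := by
  set R := Finset.univ.filter fun w => w ∉ S ∧ τ w w = τ u u with hR
  have hmem : ∀ w, w ∈ R ↔ w ∉ S ∧ τ w w = τ u u := fun w => by simp [hR]
  have huR : u ∈ R := (hmem u).mpr ⟨hu, rfl⟩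
  by_cases hsep : ∃ x ∈ S, ∃ a ∈ R, ∃ b ∈ R, τ x a ≠ τ x b
  · obtain ⟨x, hx, a, ha, b, hb, hab⟩ := hsep
    obtain ⟨c, hc, hiso⟩ := Finset.exists_isolated hcard ha hb hab
    obtain ⟨hcS, hcu⟩ := (hmem c).mp hc
    refine ⟨c, hcS, hcu, h.exists_extend hf hx hcS fun y _ w hw e => ?_⟩
    rw [hiso w ((hmem w).mpr ⟨hw, (h.self.right e).trans hcu⟩) e]
  · push Not at hsep
    obtain ⟨x, hx⟩ := hS
    refine ⟨u, hu, rfl, h.exists_extend hf hx hu fun y hy w hw e => ?_⟩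
    exact hsep y hy w ((hmem w).mpr ⟨hw, h.self.right e⟩) u huR

/-- The vertex added in one step need not be the requested one, but only lies in its fiber. Hence
the induction on the number of uncovered vertices. -/
theorem exists_extend_union (h : WLSim τ τ') {f : V → W}
    {S : Finset V} (hf : PreservesOn τ τ' f S) (hS : S.Nonempty) (U : Finset V)
    (hcard : ∀ u ∈ U, (Finset.univ.filter fun w => w ∉ S ∧ τ w w = τ u u).card ≤ 3) :
    ∃ f' : V → W, PreservesOn τ τ' f' (S ∪ U) ∧ ∀ y ∈ S, f' y = f y := by
  induction hn : (Finset.univ \ S).card using Nat.strong_induction_on generalizing f S with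
  | _ n ih =>
  by_cases hU : U ⊆ S
  · exact ⟨f, by rwa [Finset.union_eq_left.mpr hU], fun _ _ => rfl⟩
  · obtain ⟨u, huU, hu⟩ := Finset.not_subset.mp hU
    obtain ⟨b, hb, -, f₁, hf₁, he₁⟩ := h.exists_extend_fiber hf hS hu (hcard u huU)
    obtain ⟨f₂, hf₂, he₂⟩ := ih _ (by
        rw [← hn]
        refine Finset.card_lt_card (Finset.ssubset_iff_subset_ne.mpr ⟨?_, ?_⟩)
        · exact Finset.sdiff_subset_sdiff le_rfl (Finset.subset_insert b S)
        · intro e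
          have : b ∈ Finset.univ \ S := by simp [hb]
          rw [← e] at this
          simp at this) hf₁ (Finset.insert_nonempty b S) (fun w hw =>
        (Finset.card_le_card fun z hz => by
          simp only [Finset.mem_filter, Finset.mem_univ, true_and, Finset.mem_insert,
            not_or] at hz ⊢
          exact ⟨hz.1.2, hz.2⟩).trans (hcard w hw)) rfl
    refine ⟨f₂, fun x hx y hy => hf₂ x ?_ y ?_, fun y hy => ?_⟩
    · rw [Finset.insert_union]; exact Finset.mem_insert_of_mem hx
    · rw [Finset.insert_union]; exact Finset.mem_insert_of_mem hy
    · rw [he₂ y (Finset.mem_insert_of_mem hy), he₁ y hy]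

end WLSim

/-- Repetitions in `p` are harmless: by `loop` they force the same repetitions in `p'`, so any
section of `p` defines the map. -/
theorem exists_preservesOn_range {V W T ι : Type*} [Fintype ι] [DecidableEq V] {τ : V → V → T}
    {τ' : W → W → T} (h : WLSim τ τ') [Nonempty ι] (p : ι → V) (p' : ι → W)
    (hp : ∀ i j, τ (p i) (p j) = τ' (p' i) (p' j)) :
    ∃ f : V → W, PreservesOn τ τ' f (Finset.univ.image p) ∧ ∀ i, f (p i) = p' i := by
  have key : ∀ i, p' (Function.invFun p (p i)) = p' i := fun i =>
    (h.loop (hp _ _)).mp (Function.invFun_eq ⟨i, rfl⟩)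
  refine ⟨fun x => p' (Function.invFun p x), ?_, key⟩
  intro u hu v hv
  obtain ⟨i, -, rfl⟩ := Finset.mem_image.mp hu
  obtain ⟨j, -, rfl⟩ := Finset.mem_image.mp hv
  simpa only [key] using hp i j

namespace WLSim

section

variable {V W T : Type*} {τ : V → V → T} {τ' : W → W → T}

theorem card_eq [Fintype V] [Fintype W] (h : WLSim τ τ') : Fintype.card V = Fintype.card W := by
  by_cases hV : Nonempty V
  · obtain ⟨v⟩ := hV
    obtain ⟨a, b, hab⟩ := h.exists_image v v
    obtain ⟨β, -⟩ := h.exists_equiv hab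
    exact Fintype.card_congr β
  · have hW : IsEmpty W := ⟨fun w => by
      obtain ⟨a, -, -⟩ := h.exists_preimage w w
      exact hV ⟨a⟩⟩
    rw [not_nonempty_iff] at hV
    simp

theorem exists_triple (h : WLSim τ τ') (a b c : V) : ∃ a' b' c', τ a a = τ' a' a' ∧
    τ a b = τ' a' b' ∧ τ b c = τ' b' c' ∧ τ a c = τ' a' c' := by
  obtain ⟨a', ha'⟩ := h.exists_vertex a
  obtain ⟨c', hc'⟩ := h.exists_pair ha' c
  obtain ⟨b', h1, h2⟩ := h.exists_third hc' b
  exact ⟨a', b', c', ha', h1, h2, hc'⟩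

theorem exists_preservesOn_triple [DecidableEq V] (h : WLSim τ τ') {a b c : V} {a' b' c' : W}
    (hab : τ a b = τ' a' b') (hbc : τ b c = τ' b' c') (hac : τ a c = τ' a' c') :
    ∃ f : V → W, PreservesOn τ τ' f {a, b, c} ∧ f a = a' ∧ f b = b' ∧ f c = c' := by
  obtain ⟨f, hf, hf'⟩ := exists_preservesOn_range h ![a, b, c] ![a', b', c'] (by
    simp only [Fin.forall_fin_succ]
    simpa using ⟨⟨h.left hab, hab, hac⟩, ⟨h.transpose hab, h.left hbc, hbc⟩,
      h.transpose hac, h.transpose hbc, h.right hbc⟩)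
  have e : Finset.univ.image ![a, b, c] = {a, b, c} := by
    ext x
    simp [Fin.exists_fin_succ, eq_comm]
  exact ⟨f, e ▸ hf, hf' 0, hf' 1, hf' 2⟩

end

variable {V W T : Type*} [Fintype V] [Fintype W] [DecidableEq V] [DecidableEq W] [DecidableEq T]
  {τ : V → V → T} {τ' : W → W → T}

/-- A fiber of size four that meets `S` has at most three vertices left. -/
theorem exists_preservesOn_union (h : WLSim τ τ')
    (h4 : ∀ u, (Finset.univ.filter fun w => τ w w = τ u u).card ≤ 4) {f : V → W}
    {S : Finset V} (hf : PreservesOn τ τ' f S) (hS : S.Nonempty) (U : Finset V)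
    (hU : ∀ u ∈ U, 4 ≤ (Finset.univ.filter fun w => τ w w = τ u u).card →
      ∃ x ∈ S, τ x x = τ u u) :
    ∃ f' : V → W, PreservesOn τ τ' f' (S ∪ U) ∧ ∀ y ∈ S, f' y = f y := by
  refine h.exists_extend_union hf hS U fun u hu => ?_
  by_contra hlt
  have hsub : (Finset.univ.filter fun w => w ∉ S ∧ τ w w = τ u u) ⊆
      Finset.univ.filter fun w => τ w w = τ u u :=
    Finset.monotone_filter_right _ fun w _ hw => hw.2
  have h1 := Finset.card_le_card hsub
  obtain ⟨x, hx, hxu⟩ := hU u hu (by omega)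
  have h2 := Finset.eq_of_subset_of_card_le hsub (by have := h4 u; omega)
  have hx' : x ∈ Finset.univ.filter fun w => τ w w = τ u u := by simp [hxu]
  rw [← h2] at hx'
  exact (Finset.mem_filter.mp hx').2.1 hx

theorem exists_preservesOn_univ (h : WLSim τ τ')
    (h4 : ∀ u, (Finset.univ.filter fun w => τ w w = τ u u).card ≤ 4) {f : V → W}
    {S : Finset V} (hf : PreservesOn τ τ' f S) (hS : S.Nonempty)
    (hU : ∀ u, 4 ≤ (Finset.univ.filter fun w => τ w w = τ u u).card → ∃ x ∈ S, τ x x = τ u u) :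
    ∃ f' : V → W, ∀ u v, τ u v = τ' (f' u) (f' v) := by
  obtain ⟨f', hf', -⟩ := h.exists_preservesOn_union h4 hf hS Finset.univ fun u _ => hU u
  exact ⟨f', fun u v => hf' u (by simp) v (by simp)⟩

theorem exists_preserves_of_three (h : WLSim τ τ')
    (h4 : ∀ u, (Finset.univ.filter fun w => τ w w = τ u u).card ≤ 4) (a b c : V)
    (habc : ∀ u, 4 ≤ (Finset.univ.filter fun w => τ w w = τ u u).card →
      τ a a = τ u u ∨ τ b b = τ u u ∨ τ c c = τ u u) :
    ∃ f' : V → W, ∀ u v, τ u v = τ' (f' u) (f' v) := by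
  obtain ⟨a', b', c', -, h1, h2, h3⟩ := h.exists_triple a b c
  obtain ⟨f, hf, -⟩ := h.exists_preservesOn_triple h1 h2 h3
  exact h.exists_preservesOn_univ h4 hf ⟨a, by simp⟩ fun u hu => by simpa using habc u hu

/-- If the neighborhood of `b` in its fiber determined by `a` refines the one of `c`,
then the four given fibers have type-preserving transversals. -/
theorem exists_preserves_of_four (h : WLSim τ τ')
    (h4 : ∀ u, (Finset.univ.filter fun w => τ w w = τ u u).card ≤ 4) (a b c d : V)
    (habcd : ∀ u, τ a a = τ u u ∨ τ b b = τ u u ∨ τ c c = τ u u ∨ τ d d = τ u u)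
    (hdom : ∀ y, τ b y = τ b a → τ c y = τ c a) :
    ∃ f' : V → W, ∀ u v, τ u v = τ' (f' u) (f' v) := by
  obtain ⟨b', c', d', -, hbc, hcd, hbd⟩ := h.exists_triple b c d
  obtain ⟨a', hba, had⟩ := h.exists_third hbd a
  -- The one type not controlled by the triangle counts: the preimage of `a'` under the matching for
  -- the pair `(b, c)` has the same type from `b` as `a`, hence by `hdom` also the same type from
  -- `c`.
  have hca : τ c a = τ' c' a' := by
    obtain ⟨β, hβ⟩ := h.exists_equiv hbc
    obtain ⟨h1, h2⟩ := hβ (β.symm a')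
    rw [Equiv.apply_symm_apply] at h1 h2
    rw [← hdom _ (h1.symm.trans hba.symm)]
    exact h.transpose h2.symm
  obtain ⟨f, hf, -⟩ := exists_preservesOn_range h ![a, b, c, d] ![a', b', c', d'] (by
    simp only [Fin.forall_fin_succ]
    simpa using ⟨⟨h.left had, h.transpose hba, h.transpose hca, had⟩,
      ⟨hba, h.left hba, hbc, hbd⟩, ⟨hca, h.transpose hbc, h.left hcd, hcd⟩,
      h.transpose had, h.transpose hbd, h.transpose hcd, h.right hcd⟩)
  refine h.exists_preservesOn_univ h4 hf ⟨a, by simp [Fin.exists_fin_succ]⟩ fun u _ => ?_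
  simpa [Fin.exists_fin_succ] using habcd u

end WLSim

/-! ### The Klein four-group and the indexing of four fibers -/

/-- The Klein four-group. -/
abbrev Klein := ZMod 2 × ZMod 2

/-- The non-degenerate alternating form on the Klein four-group. -/
def Klein.form (a b : Klein) : ZMod 2 := a.1 * b.2 + a.2 * b.1

open Klein

namespace Klein

theorem form_add (a b c : Klein) : form a (b + c) = form a b + form a c := by
  simp only [form, Prod.fst_add, Prod.snd_add]
  ring

theorem add_self (a : Klein) : a + a = 0 := by
  revert a; decide

theorem add_ne_zero {a b : Klein} : a + b ≠ 0 ↔ a ≠ b := by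
  revert a b; decide

theorem add_add_self (a b : Klein) : a + (a + b) = b := by
  rw [← add_assoc, add_self, zero_add]

theorem form_self (a : Klein) : form a a = 0 := by
  revert a; decide

theorem form_zero (a : Klein) : form a 0 = 0 := by
  revert a; decide

theorem form_eq_zero_iff {a b : Klein} (ha : a ≠ 0) : form a b = 0 ↔ b = 0 ∨ b = a := by
  revert a b; decide

theorem exists_fourth {i j k : Klein} (hij : i ≠ j) (hik : i ≠ k) (hjk : j ≠ k) :
    ∃ l, l ≠ i ∧ l ≠ j ∧ l ≠ k ∧ ∀ m, i = m ∨ j = m ∨ k = m ∨ l = m := by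
  revert i j k; decide

theorem exists_two_others {i j : Klein} (hij : i ≠ j) :
    ∃ k l, k ≠ i ∧ k ≠ j ∧ l ≠ i ∧ l ≠ j ∧ k ≠ l ∧ ∀ m, i = m ∨ j = m ∨ k = m ∨ l = m := by
  revert i j; decide

end Klein

namespace WLSim

/-- Either three vertices meet all fibers of size four, or there are exactly four fibers, all of
them of size four. -/
theorem exists_three_or_index {V T : Type*} [Fintype V] [DecidableEq V] [DecidableEq T]
    (τ : V → V → T) [Nonempty V] (hV : Fintype.card V ≤ 16)
    (h4 : ∀ u, (Finset.univ.filter fun w => τ w w = τ u u).card ≤ 4) :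
    (∃ a b c, ∀ u, 4 ≤ (Finset.univ.filter fun w => τ w w = τ u u).card →
      τ a a = τ u u ∨ τ b b = τ u u ∨ τ c c = τ u u) ∨
    Fintype.card V = 16 ∧ ∃ idx : V → Klein, (∀ u v, idx u = idx v ↔ τ u u = τ v v) ∧
      ∀ i, (Finset.univ.filter fun w => idx w = i).card = 4 := by
  by_cases hcon : ∃ a b c, ∀ u, 4 ≤ (Finset.univ.filter fun w => τ w w = τ u u).card →
      τ a a = τ u u ∨ τ b b = τ u u ∨ τ c c = τ u u
  · exact Or.inl hcon
  right
  push Not at hcon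
  obtain ⟨o⟩ := ‹Nonempty V›
  obtain ⟨a, ha, -⟩ := hcon o o o
  obtain ⟨b, hb, hab, -⟩ := hcon a a a
  obtain ⟨c, hc, hac, hbc, -⟩ := hcon a b b
  obtain ⟨d, hd, had, hbd, hcd⟩ := hcon a b c
  set r : Klein → V := fun i => if i.1 = 0 then (if i.2 = 0 then a else b) else
    (if i.2 = 0 then c else d) with hr
  have hrinj : Function.Injective fun i => τ (r i) (r i) := by
    intro i j hij
    have : ∀ x : ZMod 2, x = 0 ∨ x = 1 := by decide
    obtain ⟨i1, i2⟩ := i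
    obtain ⟨j1, j2⟩ := j
    rcases this i1 with rfl | rfl <;> rcases this i2 with rfl | rfl <;>
      rcases this j1 with rfl | rfl <;> rcases this j2 with rfl | rfl <;>
      simp_all [eq_comm]
  have hr4 : ∀ i, 4 ≤ (Finset.univ.filter fun w => τ w w = τ (r i) (r i)).card := by
    intro i
    simp only [hr]
    split_ifs <;> assumption
  -- Four disjoint fibers of size four already have 16 vertices, so they exhaust `V`.
  set B := Finset.univ.biUnion fun i => Finset.univ.filter fun w => τ w w = τ (r i) (r i) with hB
  have hBcard : B.card = 16 := by
    rw [hB, Finset.card_biUnion, Finset.sum_congr rfl fun i _ => (h4 (r i)).antisymm (hr4 i)]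
    · simp [Klein]
    · intro i _ j _ hij
      rw [Function.onFun, Finset.disjoint_left]
      intro w hw hw'
      simp only [Finset.mem_filter, Finset.mem_univ, true_and] at hw hw'
      exact hij (hrinj (hw.symm.trans hw'))
  have hcard : Fintype.card V = 16 := le_antisymm hV (hBcard ▸ Finset.card_le_univ B)
  have huniv : B = Finset.univ := Finset.eq_univ_of_card _ (hBcard.trans hcard.symm)
  have hex : ∀ v, ∃ i, τ v v = τ (r i) (r i) := by
    intro v
    have : v ∈ B := by rw [huniv]; exact Finset.mem_univ v
    simpa [hB] using this
  choose idx hidx using hex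
  have h1 : ∀ u v, idx u = idx v ↔ τ u u = τ v v := by
    intro u v
    rw [hidx u, hidx v]
    exact hrinj.eq_iff.symm
  refine ⟨hcard, idx, h1, fun i => ?_⟩
  rw [← (h4 (r i)).antisymm (hr4 i)]
  congr 1
  ext w
  simp only [Finset.mem_filter, Finset.mem_univ, true_and]
  rw [hidx w]
  exact hrinj.eq_iff.symm

end WLSim

namespace Klein

theorem ne_add {i x : Klein} (hx : x ≠ 0) : i ≠ i + x := by
  revert i x; decide

theorem form_add_eq_zero_iff {k x y w : Klein} (hk : k ≠ 0) (hw : w ≠ x)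
    (h : form k w = form k x) : y = x ∨ y = w ↔ form k (x + y) = 0 := by
  have hk' : x + w = k := by
    have h0 : form k (x + w) = 0 := by rw [form_add, h, CharTwo.add_self_eq_zero]
    exact ((form_eq_zero_iff hk).mp h0).resolve_left (Klein.add_ne_zero.mpr hw.symm)
  rw [form_eq_zero_iff hk, ← hk', add_right_inj]
  refine or_congr_left ⟨?_, ?_⟩
  · rintro rfl
    exact Klein.add_self _
  · intro h0
    by_contra hne
    exact Klein.add_ne_zero.mpr (Ne.symm hne) h0

end Klein

/-! ### Coordinates in entangled fibers -/

/-- Four fibers of size four, indexed by the Klein four-group, such that any two fibers define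
different partitions of a third one. -/
structure Entangled {V T : Type*} [Fintype V] (τ : V → V → T) (idx : V → Klein) : Prop where
  idx_eq : ∀ u v, idx u = idx v ↔ τ u u = τ v v
  card_fiber : ∀ i, (Finset.univ.filter fun w => idx w = i).card = 4
  separates : ∀ a b c, idx a ≠ idx b → idx a ≠ idx c → idx b ≠ idx c →
    ∃ y, τ b y = τ b a ∧ τ c y ≠ τ c a

namespace Entangled

variable {V T : Type*} [Fintype V] {τ : V → V → T} {idx : V → Klein}

theorem exists_idx (e : Entangled τ idx) (i : Klein) : ∃ v, idx v = i := by
  have : 0 < (Finset.univ.filter fun w => idx w = i).card := by rw [e.card_fiber]; norm_num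
  obtain ⟨v, hv⟩ := Finset.card_pos.mp this
  exact ⟨v, by simpa using hv⟩

theorem idx_right (e : Entangled τ idx) (h : WLSim τ τ) {u v u' v' : V}
    (huv : τ u v = τ u' v') : idx v = idx v' :=
  (e.idx_eq _ _).mpr (h.right huv)

/-- The class of `a` as seen from `b` has exactly two elements. A singleton would be contained in
the class seen from any third fiber, the whole fiber would contain every such class, and a class of
three would leave a singleton. -/
theorem exists_pair_partner (e : Entangled τ idx) (h : WLSim τ τ) {a b : V}
    (hab : idx a ≠ idx b) : ∃ y, y ≠ a ∧ ∀ z, τ b z = τ b a ↔ z = a ∨ z = y := by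
  classical
  obtain ⟨k, -, hka, hkb, -⟩ := exists_two_others hab
  obtain ⟨c, rfl⟩ := e.exists_idx k
  set N : V → Finset V := fun a => Finset.univ.filter fun z => τ b z = τ b a with hN
  have hmem : ∀ a z, z ∈ N a ↔ τ b z = τ b a := fun a z => by simp [hN]
  set A := Finset.univ.filter fun z => idx z = idx a with hA
  have hmemA : ∀ z, z ∈ A ↔ idx z = idx a := fun z => by simp [hA]
  have hA4 : A.card = 4 := e.card_fiber _
  have hsub : ∀ a' ∈ A, N a' ⊆ A := fun a' ha' z hz =>
    (hmemA z).mpr ((e.idx_right h ((hmem a' z).mp hz)).trans ((hmemA a').mp ha'))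
  have haA : a ∈ A := (hmemA a).mpr rfl
  have h1 : ∀ a' ∈ A, (N a').card ≠ 1 := by
    intro a' ha' h1
    obtain ⟨z, hz⟩ := Finset.card_eq_one.mp h1
    have ha'' := (hmemA a').mp ha'
    obtain ⟨y, hy, hy'⟩ := e.separates a' b c (by rwa [ha'']) (by rw [ha'']; exact hka.symm)
      hkb.symm
    have h2 := (hmem a' y).mpr hy
    have h3 := (hmem a' a').mpr rfl
    rw [hz, Finset.mem_singleton] at h2 h3
    exact hy' (by rw [h2, h3])
  have h4 : (N a).card ≠ 4 := by
    intro h4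
    have hNA : N a = A := Finset.eq_of_subset_of_card_le (hsub a haA) (by omega)
    obtain ⟨y, hy, hy'⟩ := e.separates a c b hka.symm hab hkb
    refine hy' ((hmem a y).mp ?_)
    rw [hNA]
    exact (hmemA y).mpr (e.idx_right h hy)
  have h3 : (N a).card ≠ 3 := by
    intro h3
    obtain ⟨z, hz, hz'⟩ := Finset.exists_of_ssubset
      (Finset.ssubset_iff_subset_ne.mpr ⟨hsub a haA, fun h => by rw [h] at h3; omega⟩)
    have hd : N z ⊆ A \ N a := by
      intro w hw
      refine Finset.mem_sdiff.mpr ⟨hsub z hz hw, fun hw' => hz' ?_⟩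
      exact (hmem a z).mpr (((hmem z w).mp hw).symm.trans ((hmem a w).mp hw'))
    have hc := Finset.card_le_card hd
    rw [Finset.card_sdiff_of_subset (hsub a haA)] at hc
    have := Finset.card_pos.mpr ⟨z, (hmem z z).mpr rfl⟩
    exact h1 z hz (by omega)
  have h0 := Finset.card_pos.mpr ⟨a, (hmem a a).mpr rfl⟩
  have hle := Finset.card_le_card (hsub a haA)
  have h2 : (N a).card = 2 := by have := h1 a haA; omega
  obtain ⟨x, y, hxy, hNxy⟩ := Finset.card_eq_two.mp h2
  have ha := (hmem a a).mpr rfl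
  have hz : ∀ z, τ b z = τ b a ↔ z = x ∨ z = y := by
    intro z
    rw [← hmem, hNxy]
    simp
  rw [hNxy, Finset.mem_insert, Finset.mem_singleton] at ha
  rcases ha with rfl | rfl
  · exact ⟨y, hxy.symm, hz⟩
  · exact ⟨x, hxy, fun z => (hz z).trans or_comm⟩

/-- The partner depends only on the fiber of `b`. The two remaining fibers use up two of the three
other vertices of the fiber of `a`, and every vertex in fiber `j` must avoid both; two different
partners would give a fifth vertex. -/
theorem exists_partner (e : Entangled τ idx) (h : WLSim τ τ) {a : V} {j : Klein}
    (haj : idx a ≠ j) : ∃ y, y ≠ a ∧ ∀ b, idx b = j → ∀ z, τ b z = τ b a ↔ z = a ∨ z = y := by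
  classical
  obtain ⟨k, l, hka, hkj, hla, hlj, hkl, -⟩ := exists_two_others haj
  obtain ⟨b, rfl⟩ := e.exists_idx j
  obtain ⟨c, rfl⟩ := e.exists_idx k
  obtain ⟨d, rfl⟩ := e.exists_idx l
  obtain ⟨y, hya, hy⟩ := e.exists_pair_partner h haj
  obtain ⟨p, hpa, hp⟩ := e.exists_pair_partner h hka.symm
  obtain ⟨q, hqa, hq⟩ := e.exists_pair_partner h hla.symm
  have hidx : ∀ {b y}, τ b y = τ b a → idx y = idx a := fun hy => e.idx_right h hy
  have hne : ∀ {b c y p}, idx a ≠ idx b → idx a ≠ idx c → idx b ≠ idx c →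
      (∀ z, τ b z = τ b a ↔ z = a ∨ z = y) → (∀ z, τ c z = τ c a ↔ z = a ∨ z = p) → y ≠ p := by
    rintro b c y _ h1 h2 h3 hy hp rfl
    obtain ⟨z, hz, hz'⟩ := e.separates a b c h1 h2 h3
    exact hz' ((hp z).mpr ((hy z).mp hz))
  refine ⟨y, hya, fun b' hb' => ?_⟩
  obtain ⟨y', hya', hy'⟩ := e.exists_pair_partner h (a := a) (b := b') (by rwa [hb'])
  suffices y' = y by rwa [this] at hy'
  by_contra hyy
  have h1 : ({a, y, y', p, q} : Finset V) ⊆ Finset.univ.filter fun w => idx w = idx a := by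
    intro z hz
    simp only [Finset.mem_insert, Finset.mem_singleton] at hz
    rw [Finset.mem_filter]
    refine ⟨Finset.mem_univ z, ?_⟩
    rcases hz with rfl | rfl | rfl | rfl | rfl
    · rfl
    · exact hidx ((hy _).mpr (Or.inr rfl))
    · exact hidx ((hy' _).mpr (Or.inr rfl))
    · exact hidx ((hp _).mpr (Or.inr rfl))
    · exact hidx ((hq _).mpr (Or.inr rfl))
  have h2 := Finset.card_le_card h1
  have n1 := hne haj hka.symm hkj.symm hy hp
  have n2 := hne haj hla.symm hlj.symm hy hq
  have n3 := hne (by rwa [hb']) hka.symm (by rw [hb']; exact hkj.symm) hy' hp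
  have n4 := hne (by rwa [hb']) hla.symm (by rw [hb']; exact hlj.symm) hy' hq
  have n5 := hne hka.symm hla.symm hkl hp hq
  rw [e.card_fiber, Finset.card_insert_of_notMem, Finset.card_insert_of_notMem,
    Finset.card_insert_of_notMem, Finset.card_pair n5] at h2
  · omega
  · simp [n3, n4]
  · simp [n1, n2, Ne.symm hyy]
  · simp [hya.symm, hya'.symm, hpa.symm, hqa.symm]

/-- Coordinates in which the types between different fibers are determined by the alternating
form. -/
structure IsCoordinates (τ : V → V → T) (idx : V → Klein) (ψ : Klein × Klein ≃ V) : Prop where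
  idx_apply : ∀ p, idx (ψ p) = p.1
  cross : ∀ i x y b, idx b ≠ i →
    (τ b (ψ (i, x)) = τ b (ψ (i, y)) ↔ form (i + idx b) (x + y) = 0)

/-- Choose an origin `r i` in each fiber and let `(i, x)`, for `x ≠ 0`, be the partner of `r i` with
respect to fiber `i + x`. Fiber `j` then pairs the origin of fiber `i` with `(i, i + j)`. -/
theorem exists_isCoordinates (e : Entangled τ idx) (h : WLSim τ τ) :
    ∃ ψ : Klein × Klein ≃ V, IsCoordinates τ idx ψ := by
  classical
  choose r hr using e.exists_idx
  have hq : ∀ i x, ∃ y, idx y = i ∧ (x = 0 → y = r i) ∧ (x ≠ 0 → y ≠ r i ∧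
      ∀ b, idx b = i + x → ∀ z, τ b z = τ b (r i) ↔ z = r i ∨ z = y) := by
    intro i x
    by_cases hx : x = 0
    · exact ⟨r i, hr i, fun _ => rfl, fun h => absurd hx h⟩
    · have hix : idx (r i) ≠ i + x := by
        rw [hr]; exact ne_add hx
      obtain ⟨y, hy, hy'⟩ := e.exists_partner h hix
      obtain ⟨b, hb⟩ := e.exists_idx (i + x)
      exact ⟨y, (e.idx_right h ((hy' b hb y).mpr (Or.inr rfl))).trans (hr i),
        fun h => absurd h hx, fun _ => ⟨hy, hy'⟩⟩
  choose q hqi hq0 hq1 using hq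
  have hinj : Function.Injective fun p : Klein × Klein => q p.1 p.2 := by
    rintro ⟨i, x⟩ ⟨j, y⟩ hxy
    simp only at hxy
    obtain rfl : i = j := by rw [← hqi i x, hxy, hqi]
    congr 1
    by_contra hne
    by_cases hx : x = 0
    · exact (hq1 i y (fun hy => hne (hx.trans hy.symm))).1 (hxy ▸ hq0 i x hx)
    by_cases hy : y = 0
    · exact (hq1 i x hx).1 (hxy ▸ hq0 i y hy)
    obtain ⟨b, hb⟩ := e.exists_idx (i + x)
    obtain ⟨c, hc⟩ := e.exists_idx (i + y)
    obtain ⟨z, hz, hz'⟩ := e.separates (r i) b c (by rw [hr, hb]; exact ne_add hx)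
      (by rw [hr, hc]; exact ne_add hy) (by rw [hb, hc]; simpa using hne)
    refine hz' (((hq1 i y hy).2 c hc z).mpr ?_)
    rw [← hxy]
    exact ((hq1 i x hx).2 b hb z).mp hz
  have hcard : Fintype.card (Klein × Klein) = Fintype.card V := by
    rw [← Finset.card_univ (α := V), ← Finset.card_eq_of_equiv_fin (s := Finset.univ (α := V))
      (Finset.equivFin _)]
    have := Finset.card_eq_sum_card_fiberwise (f := idx) (s := Finset.univ) (t := Finset.univ)
      (fun _ _ => Finset.mem_coe.mpr (Finset.mem_univ _))
    rw [this]
    simp [e.card_fiber]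
  have hbij := (Fintype.bijective_iff_injective_and_card _).mpr ⟨hinj, hcard⟩
  have hidx : ∀ p : Klein × Klein, idx (Equiv.ofBijective _ hbij p) = p.1 := fun p => hqi p.1 p.2
  refine ⟨Equiv.ofBijective _ hbij, hidx, ?_⟩
  intro i x y b hb
  have hib : i + idx b ≠ 0 := Klein.add_ne_zero.mpr hb.symm
  have hbase : ∀ x, τ b (q i x) = τ b (r i) ↔ form (i + idx b) x = 0 := by
    intro x
    rw [(hq1 i (i + idx b) hib).2 b (by rw [Klein.add_add_self]), ← hq0 i 0 rfl,
      form_eq_zero_iff hib]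
    exact or_congr ⟨fun h => congrArg Prod.snd (hinj (a₁ := (i, x)) (a₂ := (i, 0)) h),
      fun h => by rw [h]⟩ ⟨fun h => congrArg Prod.snd (hinj (a₁ := (i, x)) (a₂ := (i, _)) h),
      fun h => by rw [h]⟩
  -- `hbase` only compares with the origin. For general `x`, the partner `w` of `x` has the same
  -- value of the form, and such a level set has just two elements.
  obtain ⟨z, hz, hz'⟩ := e.exists_pair_partner h (a := q i x) (b := b) (by rwa [hqi, ne_comm])
  obtain ⟨⟨i', w⟩, rfl⟩ := hbij.2 z
  have hi' : i' = i := by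
    have h1 := e.idx_right h ((hz' _).mpr (Or.inr rfl))
    simpa [hqi] using h1
  subst hi'
  change τ b (q i' x) = τ b (q i' y) ↔ _
  have hw := (hz' (q i' w)).mpr (Or.inr rfl)
  have hwx : w ≠ x := fun h => hz (by rw [h])
  have key : form (i' + idx b) w = form (i' + idx b) x := by
    have h1 := hbase w
    rw [hw, hbase x] at h1
    revert h1
    generalize form (i' + idx b) w = s
    generalize form (i' + idx b) x = t
    revert s t; decide
  have hy : (τ b (q i' y) = τ b (q i' x)) ↔ y = x ∨ y = w := by
    rw [hz']
    exact or_congr ⟨fun h => congrArg Prod.snd (hinj (a₁ := (i', y)) (a₂ := (i', x)) h),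
      fun h => by rw [h]⟩ ⟨fun h => congrArg Prod.snd (hinj (a₁ := (i', y)) (a₂ := (i', w)) h),
      fun h => by simp only [h]⟩
  rw [eq_comm, hy]
  exact form_add_eq_zero_iff hib hwx key

end Entangled

namespace Entangled.IsCoordinates

variable {V T : Type*} [Fintype V] {τ : V → V → T} {idx : V → Klein} {ψ : Klein × Klein ≃ V}

/-- The fiber `i + (x + y)` is the one that does not separate two distinct vertices `(i, x)` and
`(i, y)`, and the pair type knows which fiber this is. -/
theorem add_eq_of_inner_eq (hψ : IsCoordinates τ idx ψ) (e : Entangled τ idx) (h : WLSim τ τ)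
    {i x y x' y' : Klein} (hxy : τ (ψ (i, x)) (ψ (i, y)) = τ (ψ (i, x')) (ψ (i, y'))) :
    x + y = x' + y' := by
  have hloop : x = y ↔ x' = y' := by
    have := h.loop hxy
    simpa using this
  by_cases hne : x = y
  · rw [hne, hloop.mp hne, Klein.add_self, Klein.add_self]
  obtain ⟨b, hb⟩ := e.exists_idx (i + (x + y))
  have hib : idx b ≠ i := by
    rw [hb]; clear hxy hb hloop; revert i x y; decide
  have h1 : τ b (ψ (i, x)) = τ b (ψ (i, y)) := by
    rw [hψ.cross i x y b hib, hb, Klein.add_add_self, form_self]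
  obtain ⟨w, hw1, hw2⟩ := h.exists_third hxy.symm b
  have h2 : τ b (ψ (i, x')) = τ b (ψ (i, y')) := by
    have hwi : idx w = idx b := (e.idx_right h hw1).symm
    rw [hw2, h.transpose hw1]
    refine ((hψ.cross i x y w (by rwa [hwi])).mpr ?_)
    rw [hwi, hb, Klein.add_add_self, form_self]
  rw [hψ.cross i x' y' b hib, hb, Klein.add_add_self] at h2
  clear hxy h1 hw1 hw2
  have : x' ≠ y' := fun h => hne (hloop.mpr h)
  clear hloop hb hib
  revert x y x' y'; decide

/-- For the converse, the type of the first pair occurs at `(i, x')` as well, and the previous lemma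
leaves only `(i, y')` as the second vertex. -/
theorem inner_eq_iff (hψ : IsCoordinates τ idx ψ) (e : Entangled τ idx) (h : WLSim τ τ)
    {i x y x' y' : Klein} :
    τ (ψ (i, x)) (ψ (i, y)) = τ (ψ (i, x')) (ψ (i, y')) ↔ x + y = x' + y' := by
  refine ⟨hψ.add_eq_of_inner_eq e h, fun hxy => ?_⟩
  have h1 : τ (ψ (i, x)) (ψ (i, x)) = τ (ψ (i, x')) (ψ (i, x')) := by
    rw [← e.idx_eq, hψ.idx_apply, hψ.idx_apply]
  obtain ⟨w, hw⟩ := h.exists_pair h1 (ψ (i, y))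
  obtain ⟨⟨j, z⟩, rfl⟩ := ψ.surjective w
  have hj := e.idx_right h hw
  rw [hψ.idx_apply, hψ.idx_apply] at hj
  obtain rfl : i = j := hj
  have hz := hψ.add_eq_of_inner_eq e h hw
  rw [hxy, add_right_inj] at hz
  rw [hw, hz]

end Entangled.IsCoordinates

/-- Three fibers at a time can be mapped type-preservingly. One map on all fibers but `j` and one on
all fibers but `i` are started from the same images of `c` and `d` in the common fibers, and then
glued. -/
theorem WLSim.exists_preserves_off_pair {V W T : Type*} [Fintype V] [Fintype W] {τ : V → V → T}
    {τ' : W → W → T} (h : WLSim τ τ') {idx : V → Klein} (e : Entangled τ idx) {i j : Klein}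
    (hij : i ≠ j) : ∃ f : V → W,
      (∀ u v, ¬(idx u = i ∧ idx v = j) → ¬(idx u = j ∧ idx v = i) → τ u v = τ' (f u) (f v)) ∧
      ∀ u v, idx u = i → idx v = j → ∃ u₀ v₀, idx u₀ = i ∧ idx v₀ = j ∧
        τ u₀ v₀ = τ' (f u) (f v) := by
  classical
  obtain ⟨ψ, hψ⟩ := e.exists_isCoordinates h.self
  obtain ⟨k, l, hki, hkj, hli, hlj, hkl, hall⟩ := exists_two_others hij
  have h4 : ∀ u, (Finset.univ.filter fun w => τ w w = τ u u).card ≤ 4 := by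
    intro u
    rw [← e.card_fiber (idx u)]
    exact le_of_eq (congrArg _ (Finset.filter_congr fun w _ => (e.idx_eq w u).symm))
  obtain ⟨a, ha⟩ := e.exists_idx i
  obtain ⟨b, hb⟩ := e.exists_idx j
  obtain ⟨c, hc⟩ := e.exists_idx k
  obtain ⟨d, hd⟩ := e.exists_idx l
  obtain ⟨a', c', d', -, hac, hcd, had⟩ := h.exists_triple a c d
  obtain ⟨b', hcb, hbd⟩ := h.exists_third hcd b
  obtain ⟨f, hf, -, hfc, hfd⟩ := h.exists_preservesOn_triple hac hcd had
  obtain ⟨g, hg, -, hgc, hgd⟩ := h.exists_preservesOn_triple (h.transpose hcb) hcd hbd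
  obtain ⟨f₁, hf₁, hff₁⟩ := h.exists_preservesOn_union h4 hf ⟨a, by simp⟩
    (Finset.univ.filter fun u => idx u ≠ j) (by
      intro u hu _
      have hu' : idx u ≠ j := by simpa using hu
      simp only [← e.idx_eq, Finset.mem_insert, Finset.mem_singleton, exists_eq_or_imp,
        exists_eq_left, ha, hc, hd]
      rcases hall (idx u) with h | h | h | h
      exacts [Or.inl h, absurd h.symm hu', Or.inr (Or.inl h), Or.inr (Or.inr h)])
  obtain ⟨g₁, hg₁, hgg₁⟩ := h.exists_preservesOn_union h4 hg ⟨b, by simp⟩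
    (Finset.univ.filter fun u => idx u ≠ i) (by
      intro u hu _
      have hu' : idx u ≠ i := by simpa using hu
      simp only [← e.idx_eq, Finset.mem_insert, Finset.mem_singleton, exists_eq_or_imp,
        exists_eq_left, hb, hc, hd]
      rcases hall (idx u) with h | h | h | h
      exacts [absurd h.symm hu', Or.inl h, Or.inr (Or.inl h), Or.inr (Or.inr h)])
  have hf₁' : ∀ u v, idx u ≠ j → idx v ≠ j → τ u v = τ' (f₁ u) (f₁ v) := fun u v hu hv =>
    hf₁ u (by simp [hu]) v (by simp [hv])
  have hg₁' : ∀ u v, idx u ≠ i → idx v ≠ i → τ u v = τ' (g₁ u) (g₁ v) := fun u v hu hv =>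
    hg₁ u (by simp [hu]) v (by simp [hv])
  -- Within a fiber, the vertices have pairwise different types from a fixed vertex `c`, so the
  -- image of `c` determines the images of the whole fiber.
  have hagree : ∀ v c c', idx v = idx c → idx c ≠ i → idx c ≠ j → f₁ c = c' → g₁ c = c' →
      f₁ v = g₁ v := by
    intro v c c' hv hci hcj hfc hgc
    have h1 := hf₁' c v hcj (by rwa [hv])
    have h2 := hg₁' c v hci (by rwa [hv])
    have h3 := hf₁' c c hcj hcj
    rw [hfc] at h1 h3
    rw [hgc] at h2
    obtain ⟨β, hβ⟩ := h.exists_equiv h3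
    have key : ∀ w', τ c v = τ' c' w' → β v = w' := by
      intro w' hw'
      have h4 := (hβ (β.symm w')).1
      rw [Equiv.apply_symm_apply, ← hw'] at h4
      have h5 := e.idx_right h.self h4
      obtain ⟨⟨m, x⟩, rfl⟩ := ψ.surjective c
      obtain ⟨⟨m₁, y⟩, rfl⟩ := ψ.surjective v
      obtain ⟨⟨m₂, z⟩, hz⟩ := ψ.surjective (β.symm w')
      rw [← hz, hψ.idx_apply, hψ.idx_apply] at h5
      rw [hψ.idx_apply, hψ.idx_apply] at hv
      obtain rfl : m₁ = m := hv
      obtain rfl : m₁ = m₂ := h5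
      rw [← hz, hψ.inner_eq_iff e h.self, add_right_inj] at h4
      rw [h4, hz, Equiv.apply_symm_apply]
    exact (key _ h1).symm.trans (key _ h2)
  have hfg : ∀ v, idx v ≠ i → idx v ≠ j → f₁ v = g₁ v := by
    intro v hvi hvj
    rcases hall (idx v) with h | h | h | h
    · exact absurd h.symm hvi
    · exact absurd h.symm hvj
    · exact hagree v c c' (h.symm.trans hc.symm) (by rwa [hc]) (by rwa [hc])
        ((hff₁ c (by simp)).trans hfc) ((hgg₁ c (by simp)).trans hgc)
    · exact hagree v d d' (h.symm.trans hd.symm) (by rwa [hd]) (by rwa [hd])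
        ((hff₁ d (by simp)).trans hfd) ((hgg₁ d (by simp)).trans hgd)
  set F : V → W := fun v => if idx v = j then g₁ v else f₁ v with hF
  have hFf : ∀ v, idx v ≠ j → F v = f₁ v := fun v hv => if_neg hv
  have hFg : ∀ v, idx v ≠ i → F v = g₁ v := by
    intro v hv
    by_cases hvj : idx v = j
    · exact if_pos hvj
    · rw [hFf v hvj, hfg v hv hvj]
  have hpres : ∀ u v, ¬(idx u = i ∧ idx v = j) → ¬(idx u = j ∧ idx v = i) →
      τ u v = τ' (F u) (F v) := by
    intro u v h1 h2
    by_cases hu : idx u = j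
    · have hv : idx v ≠ i := fun hv => h2 ⟨hu, hv⟩
      have hui : idx u ≠ i := by rw [hu]; exact hij.symm
      rw [hFg u hui, hFg v hv]
      exact hg₁' u v hui hv
    · by_cases hv : idx v = j
      · have hui : idx u ≠ i := fun hu => h1 ⟨hu, hv⟩
        have hvi : idx v ≠ i := by rw [hv]; exact hij.symm
        rw [hFg u hui, hFg v hvi]
        exact hg₁' u v hui hvi
      · rw [hFf u hu, hFf v hv]
        exact hf₁' u v hu hv
  refine ⟨F, hpres, fun u v hu hv => ?_⟩
  obtain ⟨u₀, v₀, h₀⟩ := h.exists_preimage (F u) (F v)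
  have hvi : idx v ≠ i := by rw [hv]; exact hij.symm
  refine ⟨u₀, v₀, ?_, ?_, h₀⟩
  · rw [← hu, e.idx_eq, h.left h₀]
    exact (hpres u u (by simp [hu, hij]) (by simp [hu, hij])).symm
  · rw [← hv, e.idx_eq, h.right h₀]
    exact (hpres v v (by simp [hvi]) (by simp [hvi])).symm

/-! ### Non-amenable graphs are twisted graphs -/

namespace Entangled

variable {V T : Type*} [Fintype V] {τ : V → V → T} {idx : V → Klein} {ψ : Klein × Klein ≃ V}

/-- From `b`, adjacency to fiber `i` is a function of the value of the form. Since adjacent and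
non-adjacent pairs both occur, and every pair type between the fibers also occurs at `b`, this
function is not constant. -/
theorem IsCoordinates.adj_iff_left (hψ : IsCoordinates τ idx ψ) (e : Entangled τ idx)
    (h : WLSim τ τ) {adj : V → V → Prop}
    (hadj : ∀ {u v u' v'}, τ u v = τ u' v' → (adj u v ↔ adj u' v')) {i j : Klein} (hij : j ≠ i)
    (h1 : ∃ u v, idx u = j ∧ idx v = i ∧ adj u v)
    (h2 : ∃ u v, idx u = j ∧ idx v = i ∧ ¬ adj u v) {b : V} (hb : idx b = j) (x : Klein) :
    adj b (ψ (i, x)) ↔ (adj b (ψ (i, 0)) ↔ form (i + j) x = 0) := by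
  have hform : ∀ x y, form (i + j) x = form (i + j) y →
      (adj b (ψ (i, x)) ↔ adj b (ψ (i, y))) := by
    intro x y hxy
    refine hadj ((hψ.cross i x y b (by rwa [hb])).mpr ?_)
    rw [hb, form_add, hxy, CharTwo.add_self_eq_zero]
  have hex : ∀ {u v}, idx u = j → idx v = i → ∃ x, (adj u v ↔ adj b (ψ (i, x))) := by
    intro u v hu hv
    obtain ⟨w, hw⟩ := h.exists_pair ((e.idx_eq u b).mp (hu.trans hb.symm)) v
    obtain ⟨⟨m, x⟩, rfl⟩ := ψ.surjective w
    have hm := e.idx_right h hw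
    rw [hv, hψ.idx_apply] at hm
    obtain rfl : i = m := hm
    exact ⟨x, hadj hw⟩
  obtain ⟨u₁, v₁, hu₁, hv₁, a₁⟩ := h1
  obtain ⟨u₂, v₂, hu₂, hv₂, a₂⟩ := h2
  obtain ⟨x₁, hx₁⟩ := hex hu₁ hv₁
  obtain ⟨x₂, hx₂⟩ := hex hu₂ hv₂
  rw [hx₁] at a₁
  rw [hx₂] at a₂
  have hne : form (i + j) x₁ ≠ form (i + j) x₂ := fun h => a₂ ((hform _ _ h).mp a₁)
  have h0 : form (i + j) 0 = 0 := form_zero _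
  have two : ∀ s t r : ZMod 2, s ≠ t → r = s ∨ r = t := by decide
  rcases two _ _ 0 hne with h01 | h02
  · have ha0 : adj b (ψ (i, 0)) := (hform _ _ (h0.trans h01)).mpr a₁
    rcases two _ _ (form (i + j) x) hne with hx | hx
    · simp only [ha0, (hform _ _ hx).mpr a₁, hx, ← h01]
    · have h3 : ¬ adj b (ψ (i, x)) := fun h => a₂ ((hform _ _ hx).mp h)
      have h4 : form (i + j) x ≠ 0 := fun h => hne (by rw [← h01, ← h, hx])
      simp only [ha0, true_iff, h3, h4]
  · have ha0 : ¬ adj b (ψ (i, 0)) := fun h => a₂ ((hform _ _ (h0.trans h02)).mp h)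
    rcases two _ _ (form (i + j) x) hne with hx | hx
    · have h4 : form (i + j) x ≠ 0 := fun h => hne (by rw [← h02, ← h, hx])
      simp only [ha0, (hform _ _ hx).mpr a₁, h4]
    · have h3 : ¬ adj b (ψ (i, x)) := fun h => a₂ ((hform _ _ hx).mp h)
      simp only [ha0, false_iff, h3, hx, ← h02, not_true_eq_false]

theorem IsCoordinates.adj_iff (hψ : IsCoordinates τ idx ψ) (e : Entangled τ idx)
    (h : WLSim τ τ) {adj : V → V → Prop} (hsymm : ∀ u v, adj u v ↔ adj v u)
    (hadj : ∀ {u v u' v'}, τ u v = τ u' v' → (adj u v ↔ adj u' v')) {i j : Klein} (hij : i ≠ j)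
    (h1 : ∃ u v, idx u = i ∧ idx v = j ∧ adj u v)
    (h2 : ∃ u v, idx u = i ∧ idx v = j ∧ ¬ adj u v) (x y : Klein) :
    adj (ψ (i, x)) (ψ (j, y)) ↔ (adj (ψ (i, 0)) (ψ (j, 0)) ↔ form (i + j) (x + y) = 0) := by
  obtain ⟨u₁, v₁, hu₁, hv₁, a₁⟩ := h1
  obtain ⟨u₂, v₂, hu₂, hv₂, a₂⟩ := h2
  rw [hψ.adj_iff_left e h hadj hij ⟨u₁, v₁, hu₁, hv₁, a₁⟩ ⟨u₂, v₂, hu₂, hv₂, a₂⟩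
    (hψ.idx_apply _), hsymm, hψ.adj_iff_left e h hadj hij.symm
    ⟨v₁, u₁, hv₁, hu₁, (hsymm _ _).mp a₁⟩ ⟨v₂, u₂, hv₂, hu₂, fun h => a₂ ((hsymm _ _).mp h)⟩
    (hψ.idx_apply _), hsymm, form_add, add_comm j i]
  generalize form (i + j) x = s
  generalize form (i + j) y = t
  generalize adj (ψ (i, 0)) (ψ (j, 0)) = p
  have two : ∀ s : ZMod 2, s = 0 ∨ s = 1 := by decide
  rcases two s with rfl | rfl <;> rcases two t with rfl | rfl <;> by_cases hp : p <;>
    simp [hp, CharTwo.add_self_eq_zero]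

end Entangled

namespace VertexColoredGraph

variable {V W : Type u} {C : Type v}

/-- The graph of Cai, Fürer and Immerman over the complete graph on four vertices, with twists `t`
of the edges, inner graphs of the fibers determined by the digraph `D`, and colors `κ`. -/
def twisted (e : V ≃ Klein × Klein) (κ : Klein → C) (D : Klein → Klein → Prop)
    (t : Sym2 Klein → ZMod 2) : VertexColoredGraph V C where
  graph :=
    { Adj := fun u v =>
        ((e u).1 = (e v).1 ∧ u ≠ v ∧ D (e u).1 ((e u).1 + ((e u).2 + (e v).2))) ∨
        ((e u).1 ≠ (e v).1 ∧
          form ((e u).1 + (e v).1) ((e u).2 + (e v).2) = t s((e u).1, (e v).1))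
      symm := ⟨fun u v h => by
        rcases h with ⟨h1, h2, h3⟩ | ⟨h1, h2⟩
        · exact Or.inl ⟨h1.symm, h2.symm, by rwa [← h1, add_comm (e v).2]⟩
        · exact Or.inr ⟨h1.symm, by rwa [add_comm (e v).1, add_comm (e v).2, Sym2.eq_swap]⟩⟩
      loopless := ⟨fun u h => by
        rcases h with ⟨-, h, -⟩ | ⟨h, -⟩ <;> exact h rfl⟩ }
  color v := κ (e v).1

theorem adj_iff_col {G : VertexColoredGraph V C} {u v : V} :
    G.graph.Adj u v ↔ G.toColoredGraph.col u v = .edge := by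
  by_cases h : u = v
  · simp [toColoredGraph, h]
  · by_cases h' : G.graph.Adj u v <;> simp [toColoredGraph, h, h']

theorem col_loop {G : VertexColoredGraph V C} {u : V} :
    G.toColoredGraph.col u u = .loop (G.color u) := by
  simp [toColoredGraph]

theorem col_eq_of_ne {G : VertexColoredGraph V C} {H : VertexColoredGraph W C} {u v : V}
    {u' v' : W} (h : u ≠ v) (h' : u' ≠ v') (hadj : G.graph.Adj u v ↔ H.graph.Adj u' v') :
    G.toColoredGraph.col u v = H.toColoredGraph.col u' v' := by
  by_cases ha : G.graph.Adj u v
  · simp [toColoredGraph, h, h', ha, hadj.mp ha]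
  · simp [toColoredGraph, h, h', ha, mt hadj.mpr ha]

theorem _root_.ColoredGraph.isomorphic_of_col {G : ColoredGraph V C} {H : ColoredGraph W C}
    [Fintype V] [Fintype W] (hcard : Fintype.card V = Fintype.card W) (f : V → W)
    (hf : ∀ u v, G.col u v = H.col (f u) (f v)) : G.Isomorphic H := by
  have hinj : Function.Injective f := by
    intro u v huv
    by_contra hne
    refine G.loop_ne u u v hne ?_
    rw [hf, hf, huv]
  exact ⟨Equiv.ofBijective f ((Fintype.bijective_iff_injective_and_card f).mpr ⟨hinj, hcard⟩),
    fun u v => (hf u v).symm⟩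

/-- If two fibers are completely joined or completely unjoined, types between them need not be
respected, so the map that preserves all other types is already an isomorphism. -/
theorem exists_adj_and_not_adj [Fintype V] [Fintype W] {G : VertexColoredGraph V C}
    {H : ColoredGraph W (PairColor C)} (h : WLSim G.toColoredGraph.wlType H.wlType)
    (hn : ¬ G.toColoredGraph.Isomorphic H) {idx : V → Klein}
    (e : Entangled G.toColoredGraph.wlType idx) {i j : Klein} (hij : i ≠ j) :
    (∃ u v, idx u = i ∧ idx v = j ∧ G.graph.Adj u v) ∧
      ∃ u v, idx u = i ∧ idx v = j ∧ ¬ G.graph.Adj u v := by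
  by_contra hcon
  have huni : ∀ u v u' v', idx u = i → idx v = j → idx u' = i → idx v' = j →
      (G.graph.Adj u v ↔ G.graph.Adj u' v') := by
    intro u v u' v' hu hv hu' hv'
    by_contra hne
    refine hcon ?_
    by_cases ha : G.graph.Adj u v
    · exact ⟨⟨u, v, hu, hv, ha⟩, u', v', hu', hv', fun h => hne (iff_of_true ha h)⟩
    · exact ⟨⟨u', v', hu', hv', by_contra fun h => hne (iff_of_false ha h)⟩, u, v, hu, hv, ha⟩
  obtain ⟨f, hf, hf'⟩ := h.exists_preserves_off_pair e hij
  have hne : ∀ {u v}, idx u = i → idx v = j → u ≠ v := by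
    rintro u _ hu hv rfl
    exact hij (hu.symm.trans hv)
  refine hn (ColoredGraph.isomorphic_of_col h.card_eq f fun u v => ?_)
  by_cases h1 : idx u = i ∧ idx v = j
  · obtain ⟨u₀, v₀, hu₀, hv₀, h₀⟩ := hf' u v h1.1 h1.2
    exact (col_eq_of_ne (hne h1.1 h1.2) (hne hu₀ hv₀)
      (huni u v u₀ v₀ h1.1 h1.2 hu₀ hv₀)).trans (congrFun h₀ 0)
  · by_cases h2 : idx u = j ∧ idx v = i
    · obtain ⟨v₀, u₀, hv₀, hu₀, h₀⟩ := hf' v u h2.2 h2.1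
      refine (col_eq_of_ne (hne h2.2 h2.1).symm (hne hv₀ hu₀).symm ?_).trans
        (congrFun (h.transpose h₀) 0)
      rw [G.graph.adj_comm, G.graph.adj_comm u₀]
      exact huni v u v₀ u₀ h2.2 h2.1 hv₀ hu₀
    · exact congrFun (hf u v h1 h2) 0

theorem exists_eq_twisted [Fintype V] [Fintype W] {G : VertexColoredGraph V C}
    {H : ColoredGraph W (PairColor C)} (hV : Fintype.card V ≤ 16) (hm : G.colorMultiplicity ≤ 4)
    (hGH : G.toColoredGraph.WLEquiv H) (hn : ¬ G.toColoredGraph.Isomorphic H) :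
    Fintype.card V = 16 ∧ ∃ e κ D t, Function.Injective κ ∧ G = twisted e κ D t := by
  classical
  have h := hGH.wlSim
  have hτ : ¬ ∃ f : V → W, ∀ u v, G.toColoredGraph.wlType u v = H.wlType (f u) (f v) := by
    rintro ⟨f, hf⟩
    exact hn (ColoredGraph.isomorphic_of_col h.card_eq f fun u v => congrFun (hf u v) 0)
  by_cases hne : Nonempty V
  swap
  · rw [not_nonempty_iff] at hne
    exact absurd ⟨fun v => hne.elim v, fun u => hne.elim u⟩ hτ
  have hcol : ∀ {u v}, G.toColoredGraph.wlType u u = G.toColoredGraph.wlType v v →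
      G.color u = G.color v := by
    intro u v huv
    have : G.toColoredGraph.col u u = G.toColoredGraph.col v v := congrFun huv 0
    simpa [toColoredGraph] using this
  have hm' : ∀ u, (Finset.univ.filter fun w => G.color w = G.color u).card ≤ 4 := by
    intro u
    have h1 := (Finset.le_sup (f := fun v : V => Set.ncard {w : V | G.color w = G.color v})
      (Finset.mem_univ u)).trans hm
    rwa [← Set.ncard_coe_finset, Finset.coe_filter_univ]
  have hsub : ∀ u, (Finset.univ.filter fun w =>
      G.toColoredGraph.wlType w w = G.toColoredGraph.wlType u u) ⊆
      Finset.univ.filter fun w => G.color w = G.color u := fun u =>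
    Finset.monotone_filter_right _ fun w _ hw => hcol hw
  have h4 := fun u => (Finset.card_le_card (hsub u)).trans (hm' u)
  rcases WLSim.exists_three_or_index G.toColoredGraph.wlType hV h4 with
    ⟨a, b, c, habc⟩ | ⟨hcard, idx, hidx, hidx4⟩
  · exact absurd (h.exists_preserves_of_three h4 a b c habc) hτ
  have e : Entangled G.toColoredGraph.wlType idx := by
    refine ⟨hidx, hidx4, fun a b c hab hac hbc => ?_⟩
    by_contra hcon
    push Not at hcon
    obtain ⟨l, -, -, -, hall⟩ := exists_fourth hab hac hbc
    have : 0 < (Finset.univ.filter fun w => idx w = l).card := by rw [hidx4]; norm_num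
    obtain ⟨d, hd⟩ := Finset.card_pos.mp this
    obtain rfl : idx d = l := by simpa using hd
    refine hτ (h.exists_preserves_of_four h4 a b c d (fun u => ?_) hcon)
    simpa only [hidx] using hall (idx u)
  obtain ⟨ψ, hψ⟩ := e.exists_isCoordinates h.self
  have hadj : ∀ {u v u' v'}, G.toColoredGraph.wlType u v = G.toColoredGraph.wlType u' v' →
      (G.graph.Adj u v ↔ G.graph.Adj u' v') := by
    intro u v u' v' huv
    have : G.toColoredGraph.col u v = G.toColoredGraph.col u' v' := congrFun huv 0
    rw [adj_iff_col, adj_iff_col, this]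
  -- A fiber of size four fills its color class, which has at most four vertices; so color classes
  -- are fibers.
  have hcol' : ∀ u v, G.color u = G.color v ↔ idx u = idx v := by
    intro u v
    refine ⟨fun huv => ?_, fun huv => hcol ((hidx u v).mp huv)⟩
    have h1 : (Finset.univ.filter fun w =>
        G.toColoredGraph.wlType w w = G.toColoredGraph.wlType v v).card = 4 := by
      rw [← hidx4 (idx v)]
      exact congrArg _ (Finset.filter_congr fun w _ => (hidx w v).symm)
    have h2 := Finset.eq_of_subset_of_card_le (hsub v) (by rw [h1]; exact hm' v)
    have h3 : u ∈ Finset.univ.filter fun w => G.color w = G.color v := by simp [huv]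
    rw [← h2, Finset.mem_filter] at h3
    exact (hidx u v).mpr h3.2
  -- The digraph is read off from the neighbors of each origin inside its fiber, and the twist from
  -- the adjacency of origins; a twist of 0 means that the origins are adjacent.
  refine ⟨hcard, ψ.symm, fun i => G.color (ψ (i, 0)),
    fun i j => G.graph.Adj (ψ (i, 0)) (ψ (i, i + j)),
    Sym2.lift ⟨fun i j => if G.graph.Adj (ψ (i, 0)) (ψ (j, 0)) then 0 else 1, fun i j => by
      simp only [G.graph.adj_comm]⟩, ?_, ?_⟩
  · intro i j hij
    simpa [hψ.idx_apply] using (hcol' _ _).mp hij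
  obtain ⟨graph, color⟩ := G
  refine congrArg₂ VertexColoredGraph.mk ?_ ?_
  · ext u v
    obtain ⟨⟨i, x⟩, rfl⟩ := ψ.surjective u
    obtain ⟨⟨j, y⟩, rfl⟩ := ψ.surjective v
    simp only [Equiv.symm_apply_apply, Sym2.lift_mk, EmbeddingLike.apply_eq_iff_eq, Prod.mk.injEq,
      ne_eq]
    by_cases hij : i = j
    · subst hij
      simp only [true_and, not_true_eq_false, false_and, or_false]
      rw [Klein.add_add_self]
      have h1 : graph.Adj (ψ (i, x)) (ψ (i, y)) ↔ graph.Adj (ψ (i, 0)) (ψ (i, x + y)) :=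
        hadj ((hψ.inner_eq_iff e h.self).mpr (by rw [zero_add]))
      rw [← h1]
      refine ⟨fun ha => ⟨fun hxy => ?_, ha⟩, fun ha => ha.2⟩
      rw [hxy] at ha
      exact graph.loopless.irrefl _ ha
    · simp only [hij, false_and, not_false_eq_true, true_and, false_or]
      obtain ⟨a₁, a₂⟩ := exists_adj_and_not_adj h hn e hij
      have h1 := hψ.adj_iff e h.self (adj := graph.Adj) (fun u v => graph.adj_comm u v) hadj hij
        a₁ a₂ x y
      rw [h1]
      have two : ∀ s : ZMod 2, s = 0 ∨ s = 1 := by decide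
      by_cases hp : graph.Adj (ψ (i, 0)) (ψ (j, 0)) <;>
        rcases two (form (i + j) (x + y)) with hs | hs <;> simp [hp, hs]
  · funext v
    refine (hcol' _ _).mpr ?_
    rw [hψ.idx_apply]
    obtain ⟨⟨j, y⟩, rfl⟩ := ψ.surjective v
    simp [hψ.idx_apply]

end VertexColoredGraph

/-! ### 2-WL does not see the twist -/

theorem Klein.exists_ne_three (a b c : Klein) : ∃ d, d ≠ a ∧ d ≠ b ∧ d ≠ c := by
  revert a b c; decide

namespace ColoredGraph

variable {V W : Type u} {C : Type v} [Fintype V] [Fintype W]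

theorem wl_equiv {G : ColoredGraph V C} {H : ColoredGraph W C} (φ : V ≃ W)
    (hφ : ∀ u v, H.col (φ u) (φ v) = G.col u v) (i : ℕ) (u v : V) :
    H.wl i (φ u) (φ v) = G.wl i u v := by
  induction i generalizing u v with
  | zero => exact hφ u v
  | succ i ih =>
    exact Prod.ext (ih u v) (map_univ_eq_of_equiv φ fun w => Prod.ext (ih u w) (ih w v)).symm

theorem Isomorphic.wlEquiv {G : ColoredGraph V C} {H : ColoredGraph W C} (h : G.Isomorphic H) :
    G.WLEquiv H := by
  obtain ⟨φ, hφ⟩ := h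
  exact fun i => map_univ_eq_of_equiv (φ.prodCongr φ) fun p => wl_equiv φ hφ i p.1 p.2

theorem WLEquiv.trans {X : Type u} [Fintype X] {G : ColoredGraph V C} {H : ColoredGraph W C}
    {K : ColoredGraph X C} (h : G.WLEquiv H) (h' : H.WLEquiv K) : G.WLEquiv K :=
  fun i => (h i).trans (h' i)

end ColoredGraph

namespace VertexColoredGraph

variable {V W : Type u} {C : Type v}

theorem toColoredGraph_isomorphic {G : VertexColoredGraph V C} {H : VertexColoredGraph W C} :
    G.toColoredGraph.Isomorphic H.toColoredGraph ↔ G.Isomorphic H := by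
  constructor
  · rintro ⟨φ, hφ⟩
    refine ⟨⟨φ, fun {u v} => ?_⟩, fun v => ?_⟩
    · rw [adj_iff_col, adj_iff_col, hφ]
    · have := hφ v v
      rw [col_loop, col_loop] at this
      exact PairColor.loop.inj this
  · rintro ⟨φ, hφ⟩
    refine ⟨φ.toEquiv, fun u v => ?_⟩
    by_cases h : u = v
    · subst h
      rw [col_loop, col_loop]
      exact congrArg _ (hφ u)
    · have h' : φ.toEquiv u ≠ φ.toEquiv v := fun h' => h (φ.toEquiv.injective h')
      have h'' : H.graph.Adj (φ.toEquiv u) (φ.toEquiv v) ↔ G.graph.Adj u v := φ.map_rel_iff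
      exact col_eq_of_ne h' h h''

theorem Isomorphic.wlEquiv [Fintype V] [Fintype W] {G : VertexColoredGraph V C}
    {H : VertexColoredGraph W C} (h : G.Isomorphic H) : G.WLEquiv H :=
  (toColoredGraph_isomorphic.mpr h).wlEquiv

theorem twisted_congr {e : V ≃ Klein × Klein} {κ : Klein → C} {D D' : Klein → Klein → Prop}
    {t t' : Sym2 Klein → ZMod 2} (hD : ∀ i j, i ≠ j → (D i j ↔ D' i j))
    (ht : ∀ i j, i ≠ j → t s(i, j) = t' s(i, j)) : twisted e κ D t = twisted e κ D' t' := by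
  unfold twisted
  congr 2
  funext u v
  refine propext (or_congr (and_congr_right fun h1 => and_congr_right fun h2 => hD _ _ ?_)
    (and_congr_right fun h => by rw [ht _ _ h]))
  refine ne_add (Klein.add_ne_zero.mpr fun h => h2 (e.injective (Prod.ext h1 h)))

/-- The graph `twisted e κ D t` in other coordinates. -/
theorem twisted_trans {e : V ≃ Klein × Klein} {κ : Klein → C} {D : Klein → Klein → Prop}
    {t : Sym2 Klein → ZMod 2} (φ : W ≃ V) :
    (twisted (φ.trans e) κ D t).Isomorphic (twisted e κ D t) := by
  refine ⟨⟨φ, fun {u v} => ?_⟩, fun v => rfl⟩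
  change (_ ∧ φ u ≠ φ v ∧ _ ∨ _) ↔ (_ ∧ u ≠ v ∧ _ ∨ _)
  rw [φ.injective.ne_iff]
  rfl

theorem twisted_isomorphic (e : V ≃ Klein × Klein) (e' : W ≃ Klein × Klein) (κ : Klein → C)
    (D : Klein → Klein → Prop) (t : Sym2 Klein → ZMod 2) :
    (twisted e κ D t).Isomorphic (twisted e' κ D t) := by
  have := twisted_trans (e := e') (κ := κ) (D := D) (t := t) (e.trans e'.symm)
  rwa [Equiv.trans_assoc, Equiv.symm_trans_self, Equiv.trans_refl] at this

/-- The translation of the fibers by `y`. -/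
def translate (e : V ≃ Klein × Klein) (y : Klein → Klein) : Equiv.Perm V :=
  Function.Involutive.toPerm (fun v => e.symm ((e v).1, (e v).2 + y (e v).1)) fun v => by
    simp [add_assoc, Klein.add_self]

theorem apply_translate (e : V ≃ Klein × Klein) (y : Klein → Klein) (v : V) :
    e (translate e y v) = ((e v).1, (e v).2 + y (e v).1) :=
  e.apply_symm_apply _

/-- Translations keep differences within fibers, so the inner graphs do not change, while the twists
change by a coboundary. -/
theorem twisted_translate {e : V ≃ Klein × Klein} {κ : Klein → C} {D : Klein → Klein → Prop}
    {t t' : Sym2 Klein → ZMod 2} (y : Klein → Klein)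
    (ht : ∀ i j, i ≠ j → t' s(i, j) = t s(i, j) + form (i + j) (y i + y j)) :
    twisted ((translate e y).trans e) κ D t' = twisted e κ D t := by
  unfold twisted
  congr 1
  · congr 1
    funext u v
    simp only [Equiv.trans_apply, apply_translate]
    refine propext (or_congr (and_congr_right fun h1 => ?_) (and_congr_right fun h => ?_))
    · rw [h1, add_add_add_comm, Klein.add_self, add_zero]
    · rw [ht _ _ h, add_add_add_comm, form_add, add_left_inj]
  · funext v
    simp only [Equiv.trans_apply, apply_translate]

theorem wl_twisted_translate [Fintype V] {e : V ≃ Klein × Klein} {κ : Klein → C}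
    {D : Klein → Klein → Prop} {t t' : Sym2 Klein → ZMod 2} (y : Klein → Klein)
    (ht : ∀ i j, i ≠ j → t' s(i, j) = t s(i, j) + form (i + j) (y i + y j)) (n : ℕ) (u v : V) :
    (twisted e κ D t').toColoredGraph.wl n (translate e y u) (translate e y v) =
      (twisted e κ D t).toColoredGraph.wl n u v := by
  rw [← twisted_translate y ht]
  refine ColoredGraph.wl_equiv (translate e y) (fun u v => ?_) n u v
  by_cases h : u = v
  · subst h
    rw [col_loop, col_loop]
    rfl
  · have h' : translate e y u ≠ translate e y v := (translate e y).injective.ne h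
    have h'' : (twisted e κ D t').graph.Adj (translate e y u) (translate e y v) ↔
        (twisted ((translate e y).trans e) κ D t').graph.Adj u v := by
      change (_ ∧ translate e y u ≠ translate e y v ∧ _ ∨ _) ↔ (_ ∧ u ≠ v ∧ _ ∨ _)
      rw [(translate e y).injective.ne_iff]
      rfl
    exact col_eq_of_ne h' h h''

/-- A translation of fiber `k` by `m + m'` moves a twist from the edge `km` to `km'`. The third edge
at `k`, to `n`, is unaffected because `k + n = m + m'`. -/
theorem single_eq_single_add {k m m' : Klein} (hkm : k ≠ m) (hkm' : k ≠ m') (hmm : m ≠ m')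
    (i j : Klein) (hij : i ≠ j) :
    (Pi.single s(k, m) 1 : Sym2 Klein → ZMod 2) s(i, j) =
      (Pi.single s(k, m') 1 : Sym2 Klein → ZMod 2) s(i, j) +
        form (i + j) ((Pi.single k (m + m') : Klein → Klein) i +
          (Pi.single k (m + m') : Klein → Klein) j) := by
  have key : ∀ k m m' n : Klein, k ≠ m → k ≠ m' → m ≠ m' → k ≠ n →
      (if n = m then (1 : ZMod 2) else 0) = (if n = m' then 1 else 0) + form (k + n) (m + m') := by
    set_option synthInstance.maxSize 1000 in decide +kernel
  by_cases hi : k = i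
  · subst hi
    have hj : j ≠ k := hij.symm
    have := key k m m' j hkm hkm' hmm hij
    simpa [Pi.single_apply, hj, hkm, hkm'] using this
  · by_cases hj : k = j
    · subst hj
      have := key k m m' i hkm hkm' hmm hij.symm
      rw [add_comm i k]
      simpa [Pi.single_apply, hij, hkm, hkm', Sym2.eq_swap (a := i)] using this
    · simp [Ne.symm hi, Ne.symm hj, form_zero]

/-- Induction on the round: a pair not lying over the twisted edge has the same color with and
without the twist. Third vertices whose fiber completes the twisted edge are permuted by a
translation that moves the twist out of sight. -/
theorem wl_twisted_single [Fintype V] {e : V ≃ Klein × Klein} {κ : Klein → C}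
    {D : Klein → Klein → Prop} (n : ℕ) {k m : Klein} (hkm : k ≠ m) (u v : V)
    (h : s(k, m) ≠ s((e u).1, (e v).1)) :
    (twisted e κ D 0).toColoredGraph.wl n u v =
      (twisted e κ D (Pi.single s(k, m) 1)).toColoredGraph.wl n u v := by
  induction n generalizing k m u v with
  | zero =>
    by_cases huv : u = v
    · subst huv
      exact col_loop.trans (col_loop (G := twisted e κ D (Pi.single s(k, m) 1))).symm
    · have hadj : (twisted e κ D 0).graph.Adj u v ↔
          (twisted e κ D (Pi.single s(k, m) 1)).graph.Adj u v := by
        refine or_congr Iff.rfl (and_congr_right fun _ => ?_)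
        rw [Pi.single_eq_of_ne h.symm]
        rfl
      exact col_eq_of_ne huv huv hadj
  | succ n ih =>
    refine Prod.ext (ih hkm u v h) ?_
    have key : ∀ l : Klein, ∃ y : Klein, ∀ w, (e w).1 = l →
        (twisted e κ D (Pi.single s(k, m) 1)).toColoredGraph.wl n u
            (translate e (Pi.single l y) w) = (twisted e κ D 0).toColoredGraph.wl n u w ∧
        (twisted e κ D (Pi.single s(k, m) 1)).toColoredGraph.wl n
            (translate e (Pi.single l y) w) v = (twisted e κ D 0).toColoredGraph.wl n w v := by
      intro l
      by_cases hl : s(k, m) ≠ s((e u).1, l) ∧ s(k, m) ≠ s(l, (e v).1)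
      · refine ⟨0, fun w hw => ?_⟩
        have : translate e (Pi.single l 0) w = w := by
          apply e.injective
          simp [apply_translate]
        rw [this]
        exact ⟨(ih hkm u w (by rw [hw]; exact hl.1)).symm,
          (ih hkm w v (by rw [hw]; exact hl.2)).symm⟩
      · obtain ⟨p, hp, hlp, hlu, hlv, hpuv⟩ : ∃ p, s(k, m) = s(l, p) ∧ l ≠ p ∧ l ≠ (e u).1 ∧
            l ≠ (e v).1 ∧ (p = (e u).1 ∨ p = (e v).1) := by
          have hd : ∀ a b : Klein, s(k, m) = s(a, b) → a ≠ b := by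
            rintro a b hab rfl
            simp only [Sym2.eq_iff] at hab
            rcases hab with ⟨rfl, h⟩ | ⟨rfl, h⟩ <;> exact hkm h.symm
          rw [not_and_or, not_not, not_not] at hl
          rcases hl with hl | hl
          · refine ⟨(e u).1, hl.trans Sym2.eq_swap, (hd _ _ hl).symm, (hd _ _ hl).symm, ?_,
              Or.inl rfl⟩
            rintro rfl
            exact h hl
          · refine ⟨(e v).1, hl, hd _ _ hl, ?_, hd _ _ hl, Or.inr rfl⟩
            rintro rfl
            exact h hl
        -- This uses that there are four fibers: the twist on `lp` moves to `lq`, where `q` is not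
        -- the fiber of `u`, `v` or `w`.
        obtain ⟨q, hqu, hqv, hql⟩ : ∃ q, q ≠ (e u).1 ∧ q ≠ (e v).1 ∧ q ≠ l :=
          exists_ne_three _ _ _
        have hpq : p ≠ q := by
          rcases hpuv with rfl | rfl
          exacts [hqu.symm, hqv.symm]
        refine ⟨p + q, fun w hw => ?_⟩
        have hfix : ∀ x : V, l ≠ (e x).1 → translate e (Pi.single l (p + q)) x = x := by
          intro x hx
          apply e.injective
          simp [apply_translate, hx.symm]
        have h1 := fun a b => wl_twisted_translate (e := e) (κ := κ) (D := D)
          (Pi.single l (p + q)) (single_eq_single_add hlp hql.symm hpq) n a b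
        rw [hp]
        constructor
        · have h2 := h1 u w
          rw [hfix u hlu] at h2
          rw [h2, ih hql.symm u w]
          rw [hw, ne_eq, Sym2.eq_iff]
          rintro (⟨h3, -⟩ | ⟨-, h3⟩)
          exacts [hlu h3, hqu h3]
        · have h2 := h1 w v
          rw [hfix v hlv] at h2
          rw [h2, ih hql.symm w v]
          rw [hw, ne_eq, Sym2.eq_iff]
          rintro (⟨-, h3⟩ | ⟨h3, -⟩)
          exacts [hqv h3, hlv h3]
    -- The translations for different fibers of `w` combine into one bijection, since each is
    -- applied only to `w` and not to `u` or `v`.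
    choose y hy using key
    have htr : ∀ w, translate e y w = translate e (Pi.single (e w).1 (y (e w).1)) w := by
      intro w
      apply e.injective
      simp [apply_translate]
    refine map_univ_eq_of_equiv (translate e y) fun w => ?_
    obtain ⟨h1, h2⟩ := hy (e w).1 w rfl
    rw [← htr] at h1 h2
    exact Prod.ext h1 h2

/-- Pairs over the twisted edge are translated so that the twist leaves this edge; the other pairs
stay fixed. The translation depends only on the fibers of the pair, which it preserves, so this is
an involution on pairs. -/
theorem twisted_wlEquiv_single [Fintype V] (e : V ≃ Klein × Klein) (κ : Klein → C)
    (D : Klein → Klein → Prop) {k m : Klein} (hkm : k ≠ m) :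
    (twisted e κ D 0).WLEquiv (twisted e κ D (Pi.single s(k, m) 1)) := by
  intro n
  have key : ∀ p : Klein × Klein, ∃ y : Klein → Klein, ∀ u v, (e u).1 = p.1 → (e v).1 = p.2 →
      (twisted e κ D (Pi.single s(k, m) 1)).toColoredGraph.wl n (translate e y u)
          (translate e y v) = (twisted e κ D 0).toColoredGraph.wl n u v := by
    rintro ⟨i, j⟩
    by_cases h : s(k, m) = s(i, j)
    · obtain ⟨q, hqk, hqm, -⟩ := exists_ne_three k m m
      refine ⟨Pi.single k (m + q), fun u v hu hv => ?_⟩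
      rw [wl_twisted_translate _ (single_eq_single_add hkm hqk.symm hqm.symm),
        wl_twisted_single n hqk.symm]
      rw [hu, hv, ← h, ne_eq, Sym2.eq_iff]
      rintro (⟨-, h3⟩ | ⟨h3, -⟩)
      exacts [hqm h3, hkm h3]
    · refine ⟨0, fun u v hu hv => ?_⟩
      have : ∀ w, translate e 0 w = w := fun w => e.injective (by simp [apply_translate])
      rw [this, this, ← wl_twisted_single n hkm]
      rwa [hu, hv]
  choose y hy using key
  refine map_univ_eq_of_equiv (Function.Involutive.toPerm (fun p : V × V =>
    (translate e (y ((e p.1).1, (e p.2).1)) p.1, translate e (y ((e p.1).1, (e p.2).1)) p.2))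
      fun p => ?_) fun p => hy _ p.1 p.2 rfl rfl
  refine Prod.ext (e.injective ?_) (e.injective ?_) <;>
    simp [apply_translate, add_assoc, Klein.add_self]

end VertexColoredGraph

/-! ### Counting digraphs on four vertices -/

namespace DigraphCount

/-- The position of an ordered pair of distinct elements in the binary code of a digraph. -/
def position (a b : Fin 4) : ℕ := 3 * a.val + if b < a then b.val else b.val - 1

/-- The ordered pairs of distinct elements, by position. -/
def pairs : List (Fin 4 × Fin 4) :=
  [(0, 1), (0, 2), (0, 3), (1, 0), (1, 2), (1, 3), (2, 0), (2, 1), (2, 3), (3, 0), (3, 1), (3, 2)]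

/-- The number with the given binary digits, the lowest first. -/
def ofDigits (l : List Bool) : ℕ := l.foldr Nat.bit 0

/-- The binary code of a digraph. -/
def code (E : Fin 4 → Fin 4 → Bool) : ℕ := ofDigits (pairs.map fun p => E p.1 p.2)

/-- The digraph with a given binary code. -/
def decode (m : ℕ) (a b : Fin 4) : Bool := m.testBit (position a b)

/-- The positions to which the pairs are moved by all permutations. -/
def tables : List (List ℕ) :=
  ([0, 1, 2, 3] : List (Fin 4)).permutations'.map fun q =>
    pairs.map fun p => position (q.getD p.1 0) (q.getD p.2 0)

/-- The code is the smallest one in its isomorphism class. -/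
def isMin (m : ℕ) : Bool :=
  tables.all fun l => Nat.ble m
    (l.foldr (fun q r => Nat.add (Nat.mul 2 r) (Nat.mod (Nat.shiftRight m q) 2)) 0)

/-- A kernel evaluation over the 2^12 codes of loopless digraphs, counting one smallest code per
isomorphism class. -/
theorem card_isMin : ((Finset.range 4096).filter fun m => isMin m = true).card = 218 := by
  decide +kernel

theorem testBit_ofDigits (l : List Bool) (k : ℕ) : (ofDigits l).testBit k = l.getD k false := by
  induction l generalizing k with
  | nil => simp [ofDigits]
  | cons b l ih =>
    cases k with
    | zero => exact Nat.testBit_bit_zero b _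
    | succ k => exact (Nat.testBit_bit_succ _ _ _).trans (ih k)

theorem getElem_pairs : ∀ a b : Fin 4, a ≠ b →
    pairs[position a b]? = some (a, b) := by decide

theorem decode_code (E : Fin 4 → Fin 4 → Bool) {a b : Fin 4} (hab : a ≠ b) :
    decode (code E) a b = E a b := by
  rw [decode, code, testBit_ofDigits, List.getD_eq_getElem?_getD, List.getElem?_map,
    getElem_pairs a b hab]
  rfl

theorem code_congr {E E' : Fin 4 → Fin 4 → Bool} (h : ∀ a b, a ≠ b → E a b = E' a b) :
    code E = code E' := by
  have key : ∀ p ∈ pairs, p.1 ≠ p.2 := by decide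
  exact congrArg ofDigits (List.map_congr_left fun p hp => h _ _ (key p hp))

theorem code_decode {m : ℕ} (hm : m < 4096) : code (decode m) = m := by
  refine Nat.eq_of_testBit_eq fun k => ?_
  rw [code, testBit_ofDigits, List.getD_eq_getElem?_getD, List.getElem?_map]
  by_cases hk : k < 12
  · have key : ∀ k < 12, ∃ a b, pairs[k]? = some (a, b) ∧ position a b = k := by decide
    obtain ⟨a, b, h1, h2⟩ := key k hk
    rw [h1, ← h2]
    rfl
  · have : 12 ≤ k := not_lt.mp hk
    rw [List.getElem?_eq_none this, Nat.testBit_lt_two_pow]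
    · rfl
    · exact hm.trans_le (Nat.pow_le_pow_right (n := 2) (by norm_num) this)

theorem code_lt (E : Fin 4 → Fin 4 → Bool) : code E < 4096 := by
  refine Nat.lt_pow_two_of_testBit (n := 12) _ fun k hk => ?_
  rw [code, testBit_ofDigits, List.getD_eq_getElem?_getD, List.getElem?_map,
    List.getElem?_eq_none hk]
  rfl

/-- Links the explicit lists used in the evaluation to the abstract permutations. -/
theorem mem_tables : ∀ l, l ∈ tables ↔
    ∃ π : Equiv.Perm (Fin 4), l = pairs.map fun p => position (π p.1) (π p.2) := by
  have h1 : ∀ π : Equiv.Perm (Fin 4), (pairs.map fun p => position (π p.1) (π p.2)) ∈ tables := by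
    decide +kernel
  have h2 : ∀ l ∈ tables, ∃ π : Equiv.Perm (Fin 4),
      l = pairs.map fun p => position (π p.1) (π p.2) := by
    decide +kernel
  exact fun l => ⟨h2 l, fun ⟨π, h⟩ => h ▸ h1 π⟩

theorem isMin_iff {m : ℕ} : isMin m = true ↔
    ∀ π : Equiv.Perm (Fin 4), m ≤ code fun a b => decode m (π a) (π b) := by
  have step : ∀ q r, Nat.add (Nat.mul 2 r) (Nat.mod (Nat.shiftRight m q) 2) =
      Nat.bit (m.testBit q) r := by
    intro q r
    change 2 * r + (m >>> q) % 2 = _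
    rw [Nat.shiftRight_eq_div_pow, ← Nat.toNat_testBit, Nat.bit_val]
  have key : ∀ π : Equiv.Perm (Fin 4), (code fun a b => decode m (π a) (π b)) =
      (pairs.map fun p => position (π p.1) (π p.2)).foldr
        (fun q r => Nat.add (Nat.mul 2 r) (Nat.mod (Nat.shiftRight m q) 2)) 0 := by
    intro π
    simp only [step]
    rw [code, ofDigits, List.foldr_map, List.foldr_map]
    rfl
  simp only [isMin, List.all_eq_true, Nat.ble_eq, mem_tables, key]
  exact ⟨fun h π => h _ ⟨π, rfl⟩, fun h l ⟨π, hl⟩ => hl ▸ h π⟩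

/-- Isomorphism of loopless digraphs. -/
def digraphSetoid (α : Type*) : Setoid (α → α → Prop) where
  r D D' := ∃ π : Equiv.Perm α, ∀ i j, i ≠ j → (D i j ↔ D' (π i) (π j))
  iseqv := by
    refine ⟨fun D => ⟨1, fun i j _ => Iff.rfl⟩, ?_, ?_⟩
    · rintro D D' ⟨π, h⟩
      refine ⟨π⁻¹, fun i j hij => ?_⟩
      rw [h _ _ (π⁻¹.injective.ne hij)]
      simp
    · rintro D D' D'' ⟨π, h⟩ ⟨ρ, h'⟩
      exact ⟨ρ * π, fun i j hij => (h i j hij).trans (h' _ _ (π.injective.ne hij))⟩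

theorem card_digraphs (α : Type*) [Fintype α] (hα : Fintype.card α = 4) :
    Nat.card (Quotient (digraphSetoid α)) = 218 := by
  classical
  rw [← card_isMin, ← Fintype.card_coe, ← Nat.card_eq_fintype_card]
  symm
  have b : α ≃ Fin 4 := Fintype.equivFinOfCardEq hα
  refine Nat.card_eq_of_bijective (fun m => Quotient.mk (digraphSetoid α) fun i j =>
    decode m.1 (b i) (b j) = true) ⟨?_, ?_⟩
  · have key : ∀ m m' : ℕ, m < 4096 → isMin m' = true → ∀ π : Equiv.Perm α,
        (∀ i j, i ≠ j → (decode m (b i) (b j) = true ↔ decode m' (b (π i)) (b (π j)) = true)) →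
        m' ≤ m := by
      intro m m' hm hmin π h
      refine (isMin_iff.mp hmin (b.symm.trans (π.trans b))).trans (le_of_eq ?_)
      rw [← code_decode hm]
      refine code_congr fun x y hxy => ?_
      have := h (b.symm x) (b.symm y) (b.symm.injective.ne hxy)
      rw [b.apply_symm_apply, b.apply_symm_apply] at this
      exact (Bool.eq_iff_iff.mpr this).symm
    rintro ⟨m, hm⟩ ⟨m', hm'⟩ h
    simp only [Finset.mem_filter, Finset.mem_range] at hm hm'
    have h1 := Quotient.exact h
    have h2 := (digraphSetoid α).symm h1
    obtain ⟨π, h1⟩ := h1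
    obtain ⟨ρ, h2⟩ := h2
    exact Subtype.ext (le_antisymm (key m' m hm'.1 hm.2 ρ h2) (key m m' hm.1 hm'.2 π h1))
  · intro Q
    obtain ⟨D, rfl⟩ := Quotient.exists_rep Q
    set E : Equiv.Perm (Fin 4) → Fin 4 → Fin 4 → Bool := fun π x y =>
      decide (D (b.symm (π x)) (b.symm (π y))) with hE
    -- The relabeling with the smallest code represents the class.
    obtain ⟨π, -, hπ⟩ := Finset.exists_min_image Finset.univ (fun π => code (E π))
      Finset.univ_nonempty
    have hmin : isMin (code (E π)) = true := by
      refine isMin_iff.mpr fun ρ => (hπ (π * ρ) (Finset.mem_univ _)).trans (le_of_eq ?_)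
      exact code_congr fun x y hxy => (decode_code (E π) (ρ.injective.ne hxy)).symm
    refine ⟨⟨code (E π), Finset.mem_filter.mpr ⟨Finset.mem_range.mpr (code_lt _), hmin⟩⟩, ?_⟩
    refine Quotient.sound ⟨b.trans (π.trans b.symm), fun i j hij => ?_⟩
    simp only
    rw [decode_code _ (b.injective.ne hij)]
    simp [hE]

end DigraphCount

/-! ### Affine permutations and normalization of twists -/

namespace Klein

theorem exists_form_eq {k l : Klein} (hk : k ≠ 0) (hl : l ≠ 0) (hkl : k ≠ l) (a b : ZMod 2) :
    ∃ y, form k y = a ∧ form l y = b := by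
  revert k l a b
  set_option synthInstance.maxSize 1000 in decide +kernel

theorem form_congr {a b a' b' : Klein} (ha : a = 0 ↔ a' = 0) (hb : b = 0 ↔ b' = 0)
    (hab : a = b ↔ a' = b') : form a b = form a' b' := by
  revert a b a' b'
  set_option synthInstance.maxSize 1000 in decide +kernel

theorem eq_add_of_ne {a b c d : Klein} (hab : a ≠ b) (hac : a ≠ c) (had : a ≠ d) (hbc : b ≠ c)
    (hbd : b ≠ d) (hcd : c ≠ d) : d = a + b + c := by
  revert a b c d
  set_option synthInstance.maxSize 1000 in decide +kernel

theorem add_add_ne {a b c : Klein} (hab : a ≠ b) (hac : a ≠ c) (hbc : b ≠ c) :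
    a ≠ a + b + c ∧ b ≠ a + b + c ∧ c ≠ a + b + c := by
  revert a b c; decide

/-- Every permutation of the Klein four-group is affine. -/
theorem perm_add_add (π : Equiv.Perm Klein) (a b c : Klein) :
    π (a + b + c) = π a + π b + π c := by
  by_cases hab : a = b
  · subst hab
    simp [Klein.add_self]
  by_cases hac : a = c
  · subst hac
    rw [add_right_comm, Klein.add_self, zero_add, add_right_comm, Klein.add_self, zero_add]
  by_cases hbc : b = c
  · subst hbc
    rw [add_assoc, Klein.add_self, add_zero, add_assoc, Klein.add_self, add_zero]
  obtain ⟨h1, h2, h3⟩ := add_add_ne hab hac hbc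
  exact eq_add_of_ne (π.injective.ne hab) (π.injective.ne hac) (π.injective.ne h1)
    (π.injective.ne hbc) (π.injective.ne h2) (π.injective.ne h3)

theorem add_eq_zero {a b : Klein} : a + b = 0 ↔ a = b :=
  not_iff_not.mp Klein.add_ne_zero

/-- The form depends only on which arguments vanish or coincide. For differences of points this is
preserved by any permutation, because permutations are affine. -/
theorem form_perm (π : Equiv.Perm Klein) (i j x y : Klein) :
    form (π i + π j) (π x + π y) = form (i + j) (x + y) := by
  refine form_congr ?_ ?_ ?_
  · rw [add_eq_zero, add_eq_zero, π.apply_eq_iff_eq]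
  · rw [add_eq_zero, add_eq_zero, π.apply_eq_iff_eq]
  · have key : ∀ a b c d : Klein, a + b = c + d ↔ a = b + c + d := fun a b c d => by
      rw [← add_eq_zero, ← add_eq_zero (a := a)]
      simp only [add_assoc]
    rw [key, key, ← perm_add_add, π.apply_eq_iff_eq]

theorem sym2_cases {i j : Klein} (hij : i ≠ j) :
    s(i, j) = s(0, (1, 0)) ∨ s(i, j) = s(0, (0, 1)) ∨ s(i, j) = s(0, (1, 1)) ∨
    s(i, j) = s((1, 0), (0, 1)) ∨ s(i, j) = s((1, 0), (1, 1)) ∨ s(i, j) = s((0, 1), (1, 1)) := by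
  simp only [Sym2.eq_iff]
  revert i j
  set_option synthInstance.maxSize 1000 in decide +kernel

/-- Each point is paired with the sum of the three directions at its index, which is 0. Hence the
total twist is invariant under translations. -/
theorem sum_form (a b c d : Klein) :
    form (0 + (1, 0)) (a + b) + form (0 + (0, 1)) (a + c) + form (0 + (1, 1)) (a + d) +
      form ((1, 0) + (0, 1)) (b + c) + form ((1, 0) + (1, 1)) (b + d) +
      form ((0, 1) + (1, 1)) (c + d) = 0 := by
  revert a b c d
  set_option synthInstance.maxSize 1000 in decide +kernel

/-- The twist of size `ε` of a fixed edge. -/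
def twist (ε : ZMod 2) : Sym2 Klein → ZMod 2 := Pi.single s(0, (1, 0)) ε

theorem twist_same {ε : ZMod 2} : twist ε s(0, (1, 0)) = ε :=
  Pi.single_eq_same (M := fun _ : Sym2 Klein => ZMod 2) _ ε

theorem twist_of_ne {ε : ZMod 2} {z : Sym2 Klein} (hz : z ≠ s(0, (1, 0))) : twist ε z = 0 :=
  Pi.single_eq_of_ne (M := fun _ : Sym2 Klein => ZMod 2) hz ε

/-- With the origin of fiber `0` fixed, the two independent directions at each other fiber suffice
to clear five of the six edges: `yq` and `yr` clear the triangle on `0`, `(0, 1)`, `(1, 1)`, and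
`yp` clears the edges from `(1, 0)` to the last two of these. -/
theorem exists_normalize (t : Sym2 Klein → ZMod 2) : ∃ (y : Klein → Klein) (ε : ZMod 2),
    ∀ i j, i ≠ j → twist ε s(i, j) = t s(i, j) + form (i + j) (y i + y j) := by
  obtain ⟨yq, hq1, hq2⟩ := exists_form_eq (k := 0 + (0, 1)) (l := (0, 1) + (1, 1)) (by decide)
    (by decide) (by decide) (t s(0, (0, 1))) (t s((0, 1), (1, 1)))
  obtain ⟨yr, hr1, hr2⟩ := exists_form_eq (k := 0 + (1, 1)) (l := (0, 1) + (1, 1)) (by decide)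
    (by decide) (by decide) (t s(0, (1, 1))) 0
  obtain ⟨yp, hp1, hp2⟩ := exists_form_eq (k := (1, 0) + (0, 1)) (l := (1, 0) + (1, 1))
    (by decide) (by decide) (by decide) (t s((1, 0), (0, 1)) + form ((1, 0) + (0, 1)) yq)
    (t s((1, 0), (1, 1)) + form ((1, 0) + (1, 1)) yr)
  set y : Klein → Klein := fun i => if i = (1, 0) then yp else if i = (0, 1) then yq else
    if i = (1, 1) then yr else 0 with hy
  have y0 : y 0 = 0 := rfl
  have y1 : y (1, 0) = yp := rfl
  have y2 : y (0, 1) = yq := rfl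
  have y3 : y (1, 1) = yr := rfl
  set ε := t s(0, (1, 0)) + form (0 + (1, 0)) yp with hε
  set δ : Sym2 Klein → ZMod 2 := Sym2.lift ⟨fun i j => form (i + j) (y i + y j), fun i j => by
    simp only [add_comm i j, add_comm (y i)]⟩ with hδ
  refine ⟨y, ε, fun i j hij => ?_⟩
  change _ = t s(i, j) + δ s(i, j)
  have two : ∀ a : ZMod 2, a + a = 0 := by decide
  rcases sym2_cases hij with h | h | h | h | h | h <;> rw [h]
  · rw [twist_same, hδ, Sym2.lift_mk, hε]
    simp only [y0, y1, zero_add]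
  · rw [twist_of_ne (by decide), hδ, Sym2.lift_mk]
    simp only [y0, y2, zero_add] at hq1 ⊢
    rw [hq1, two]
  · rw [twist_of_ne (by decide), hδ, Sym2.lift_mk]
    simp only [y0, y3, zero_add] at hr1 ⊢
    rw [hr1, two]
  · rw [twist_of_ne (by decide), hδ, Sym2.lift_mk]
    simp only [y1, y2]
    rw [form_add, hp1, add_assoc, two, add_zero, two]
  · rw [twist_of_ne (by decide), hδ, Sym2.lift_mk]
    simp only [y1, y3]
    rw [form_add, hp2, add_assoc, two, add_zero, two]
  · rw [twist_of_ne (by decide), hδ, Sym2.lift_mk]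
    simp only [y2, y3]
    rw [form_add, hq2, hr2, add_zero, two]

end Klein

/-! ### Invariants of twisted graphs -/

namespace VertexColoredGraph

variable {V W : Type u} {C : Type v}

theorem exists_twisted_eq_twist (e : V ≃ Klein × Klein) (κ : Klein → C)
    (D : Klein → Klein → Prop) (t : Sym2 Klein → ZMod 2) :
    ∃ e' ε, twisted e κ D t = twisted e' κ D (twist ε) := by
  obtain ⟨y, ε, h⟩ := exists_normalize t
  exact ⟨_, ε, (twisted_translate y h).symm⟩

theorem exists_twisted_eq_perm (e : V ≃ Klein × Klein) {κ κ' : Klein → C}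
    {D D' : Klein → Klein → Prop} (t : Sym2 Klein → ZMod 2) (π : Equiv.Perm Klein)
    (hκ : ∀ i, κ' (π i) = κ i) (hD : ∀ i j, i ≠ j → (D i j ↔ D' (π i) (π j))) :
    ∃ e' t', twisted e κ D t = twisted e' κ' D' t' := by
  have h1 : twisted e κ D t = twisted e κ (fun i j => D' (π i) (π j)) t :=
    twisted_congr hD fun _ _ _ => rfl
  -- Fibers are permuted by `π`, and points inside a fiber by its linear part `x ↦ π x + π 0`.
  refine ⟨e.trans (π.prodCongr (π.trans (Equiv.addRight (π 0)))),
    fun z => t (z.map π.symm), ?_⟩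
  rw [h1]
  unfold twisted
  congr 1
  · congr 1
    funext u v
    simp only [Equiv.trans_apply, Equiv.prodCongr_apply, Prod.map, Equiv.coe_addRight,
      π.apply_eq_iff_eq, Sym2.map_mk, Equiv.symm_apply_apply, ne_eq]
    have h2 : π (e u).2 + π 0 + (π (e v).2 + π 0) = π (e u).2 + π (e v).2 := by
      rw [add_add_add_comm, Klein.add_self, add_zero]
    rw [h2, form_perm, ← add_assoc, perm_add_add, add_assoc]
  · funext v
    exact (hκ _).symm

/-- Four vertices of different colors are pairwise adjacent. -/
def HasRainbowClique (G : VertexColoredGraph V C) : Prop :=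
  ∃ x : Klein → V, ∀ i j, i ≠ j → G.color (x i) ≠ G.color (x j) ∧ G.graph.Adj (x i) (x j)

theorem Isomorphic.hasRainbowClique {G : VertexColoredGraph V C} {H : VertexColoredGraph W C}
    (h : G.Isomorphic H) (hG : G.HasRainbowClique) : H.HasRainbowClique := by
  obtain ⟨φ, hφ⟩ := h
  obtain ⟨x, hx⟩ := hG
  refine ⟨fun i => φ (x i), fun i j hij => ⟨?_, φ.map_rel_iff.mpr (hx i j hij).2⟩⟩
  rw [hφ, hφ]
  exact (hx i j hij).1

theorem hasRainbowClique_rename {G : VertexColoredGraph V C} {σ : Equiv.Perm C} :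
    (G.rename σ).HasRainbowClique ↔ G.HasRainbowClique :=
  exists_congr fun _ => forall_congr' fun _ => forall_congr' fun _ => forall_congr' fun _ =>
    and_congr_left fun _ => σ.injective.ne_iff

/-- A rainbow clique selects one vertex per fiber whose form values realize all six twists. These
values sum to 0, whereas the twists sum to `ε`; for `ε = 0` the origins form such a clique. -/
theorem hasRainbowClique_twisted {e : V ≃ Klein × Klein} {κ : Klein → C}
    (hκ : Function.Injective κ) {D : Klein → Klein → Prop} {ε : ZMod 2} :
    (twisted e κ D (twist ε)).HasRainbowClique ↔ ε = 0 := by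
  constructor
  · rintro ⟨x, hx⟩
    set f : Klein → Klein := fun i => (e (x i)).1 with hf
    have hinj : Function.Injective f := by
      intro i j hij
      by_contra hne
      exact (hx i j hne).1 (congrArg κ hij)
    have hbij := Finite.injective_iff_bijective.mp hinj
    set g := (Equiv.ofBijective f hbij).symm with hg
    have hfg : ∀ i, (e (x (g i))).1 = i := fun i => (Equiv.ofBijective f hbij).apply_symm_apply i
    set z : Klein → Klein := fun i => (e (x (g i))).2 with hz
    have key : ∀ i j, i ≠ j → form (i + j) (z i + z j) = twist ε s(i, j) := by
      intro i j hij
      rcases (hx (g i) (g j) (g.injective.ne hij)).2 with ⟨h1, -⟩ | ⟨-, h2⟩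
      · rw [hfg, hfg] at h1
        exact absurd h1 hij
      · rwa [hfg, hfg] at h2
    have h0 := sum_form (z 0) (z (1, 0)) (z (0, 1)) (z (1, 1))
    rw [key 0 (1, 0) (by decide), key 0 (0, 1) (by decide), key 0 (1, 1) (by decide),
      key (1, 0) (0, 1) (by decide), key (1, 0) (1, 1) (by decide),
      key (0, 1) (1, 1) (by decide), twist_same,
      twist_of_ne (by decide), twist_of_ne (by decide), twist_of_ne (by decide),
      twist_of_ne (by decide), twist_of_ne (by decide)] at h0
    simpa using h0
  · rintro rfl
    refine ⟨fun i => e.symm (i, 0), fun i j hij => ⟨fun h => hij ?_, Or.inr ?_⟩⟩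
    · simpa [twisted] using hκ h
    · simpa [twist, form_zero] using hij

/-- Relabeling the fibers may move the twist; after normalization its size is still `ε`, because
rainbow cliques detect it. -/
theorem twisted_twist_isomorphic (e : V ≃ Klein × Klein) (e' : W ≃ Klein × Klein)
    {κ κ' : Klein → C} (hκ' : Function.Injective κ') {D D' : Klein → Klein → Prop} (ε : ZMod 2)
    (π : Equiv.Perm Klein) (hκ : ∀ i, κ' (π i) = κ i)
    (hD : ∀ i j, i ≠ j → (D i j ↔ D' (π i) (π j))) :
    (twisted e κ D (twist ε)).Isomorphic (twisted e' κ' D' (twist ε)) := by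
  have hκi : Function.Injective κ := by
    intro i j hij
    rw [← hκ, ← hκ] at hij
    exact π.injective (hκ' hij)
  obtain ⟨e₁, t, h1⟩ := exists_twisted_eq_perm e (twist ε) π hκ hD
  obtain ⟨e₂, ε', h2⟩ := exists_twisted_eq_twist e₁ κ' D' t
  have h3 := h1.trans h2
  have h4 : ε = 0 ↔ ε' = 0 := by
    rw [← hasRainbowClique_twisted (e := e) (D := D) hκi, h3, hasRainbowClique_twisted hκ']
  have h5 : ε = ε' := by
    revert h4
    clear * -
    revert ε ε'; decide
  rw [h3, h5]
  exact twisted_isomorphic e₂ e' κ' D' (twist ε')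

theorem twisted_zero_wlEquiv_twist [Fintype V] (e : V ≃ Klein × Klein) (κ : Klein → C)
    (D : Klein → Klein → Prop) (ε : ZMod 2) :
    (twisted e κ D (twist 0)).WLEquiv (twisted e κ D (twist ε)) := by
  have two : ε = 0 ∨ ε = 1 := by revert ε; decide
  rcases two with rfl | rfl
  · exact fun _ => rfl
  · have h := twisted_wlEquiv_single e κ D (k := 0) (m := (1, 0)) (by decide)
    have h0 : twist 0 = 0 := Pi.single_zero _
    rwa [h0]

theorem twisted_wlEquiv_twist [Fintype V] (e : V ≃ Klein × Klein) (κ : Klein → C)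
    (D : Klein → Klein → Prop) (ε ε' : ZMod 2) :
    (twisted e κ D (twist ε)).WLEquiv (twisted e κ D (twist ε')) :=
  (twisted_zero_wlEquiv_twist e κ D ε).symm.trans (twisted_zero_wlEquiv_twist e κ D ε')

theorem color_eq_of_wlType_eq [Fintype V] [Fintype W] {G : VertexColoredGraph V C}
    {H : VertexColoredGraph W C} {u : V} {u' : W}
    (h : G.toColoredGraph.wlType u u = H.toColoredGraph.wlType u' u') :
    G.color u = H.color u' := by
  have h0 : G.toColoredGraph.col u u = H.toColoredGraph.col u' u' := congrFun h 0
  rw [col_loop, col_loop] at h0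
  exact PairColor.loop.inj h0

/-- Two distinct vertices of fiber `i` have a common neighbor in fiber `j` exactly if they differ by
`i + j`. So an arc of the digraph is a triangle with two vertices in fiber `i` and one in fiber `j`,
and 2-WL matches triangles. -/
theorem digraph_of_wlEquiv [Fintype V] [Fintype W] {e : V ≃ Klein × Klein}
    {e' : W ≃ Klein × Klein} {κ κ' : Klein → C} (hκ' : Function.Injective κ')
    {D D' : Klein → Klein → Prop} {t t' : Sym2 Klein → ZMod 2}
    (h : (twisted e κ D t).WLEquiv (twisted e' κ' D' t')) {i j i' j' : Klein} (hij : i ≠ j)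
    (hij' : i' ≠ j') (hi : κ' i' = κ i) (hj : κ' j' = κ j) (hD : D i j) : D' i' j' := by
  have hsim := ColoredGraph.WLEquiv.wlSim h
  have hadj : ∀ {u v u' v'}, (twisted e κ D t).toColoredGraph.wlType u v =
      (twisted e' κ' D' t').toColoredGraph.wlType u' v' → (twisted e κ D t).graph.Adj u v →
      (twisted e' κ' D' t').graph.Adj u' v' := by
    intro u v u' v' huv ha
    rw [adj_iff_col] at ha ⊢
    rw [← ha]
    exact (congrFun huv 0).symm
  -- Only the value in direction `i + j` matters; the second direction is any other nonzero one.
  obtain ⟨y, hy, -⟩ := exists_form_eq (k := i + j) (l := i + j + (if i + j = (1, 0) then (0, 1)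
    else (1, 0))) (Klein.add_ne_zero.mpr hij) (by clear * -; revert i j; decide)
    (by clear * -; revert i j; decide) (t s(i, j)) 0
  have a1 : (twisted e κ D t).graph.Adj (e.symm (i, 0)) (e.symm (i, i + j)) := by
    refine Or.inl ⟨by simp, ?_, by simpa [Klein.add_add_self] using hD⟩
    intro he
    have := congrArg Prod.snd (e.symm.injective he)
    exact Klein.add_ne_zero.mpr hij this.symm
  have a2 : (twisted e κ D t).graph.Adj (e.symm (i, 0)) (e.symm (j, y)) := by
    refine Or.inr ⟨by simpa using hij, by simpa using hy⟩
  have a3 : (twisted e κ D t).graph.Adj (e.symm (j, y)) (e.symm (i, i + j)) := by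
    refine Or.inr ⟨by simpa using hij.symm, ?_⟩
    simp only [Equiv.apply_symm_apply]
    rw [add_comm j i, form_add, form_self, add_zero, hy, Sym2.eq_swap]
  obtain ⟨u', v', huv⟩ := hsim.exists_image (e.symm (i, 0)) (e.symm (i, i + j))
  obtain ⟨w', hw1, hw2⟩ := hsim.exists_third huv (e.symm (j, y))
  have c1 := color_eq_of_wlType_eq (hsim.left huv)
  have c2 := color_eq_of_wlType_eq (hsim.right huv)
  have c3 := color_eq_of_wlType_eq (hsim.right hw1)
  have b1 := hadj huv a1
  have b2 := hadj hw1 a2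
  have b3 := hadj hw2 a3
  simp only [twisted, Equiv.apply_symm_apply] at c1 c2 c3
  have d1 : (e' u').1 = i' := hκ' (c1.symm.trans hi.symm)
  have d2 : (e' v').1 = i' := hκ' (c2.symm.trans hi.symm)
  have d3 : (e' w').1 = j' := hκ' (c3.symm.trans hj.symm)
  rcases b1 with ⟨-, hne, b1⟩ | ⟨h1, -⟩
  swap
  · exact absurd (d1.trans d2.symm) h1
  rcases b2 with ⟨h2, -⟩ | ⟨-, b2⟩
  · exact absurd (d1.symm.trans (h2.trans d3)) hij'
  rcases b3 with ⟨h2, -⟩ | ⟨-, b3⟩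
  · exact absurd (d2.symm.trans (h2.symm.trans d3)) hij'
  rw [d1] at b1
  rw [d1, d3, form_add] at b2
  rw [d2, d3, add_comm j' i', form_add, Sym2.eq_swap, ← b2, add_comm, add_left_inj] at b3
  have h0 : form (i' + j') ((e' u').2 + (e' v').2) = 0 := by
    rw [form_add, b3, CharTwo.add_self_eq_zero]
  rcases (form_eq_zero_iff (Klein.add_ne_zero.mpr hij')).mp h0 with h0 | h0
  · exact absurd (e'.injective (Prod.ext (d1.trans d2.symm) (add_eq_zero.mp h0))) hne
  · rwa [h0, Klein.add_add_self] at b1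

theorem exists_perm_of_wlEquiv [Fintype V] [Fintype W] {e : V ≃ Klein × Klein}
    {e' : W ≃ Klein × Klein} {κ κ' : Klein → C} (hκ : Function.Injective κ)
    (hκ' : Function.Injective κ') {D D' : Klein → Klein → Prop} {t t' : Sym2 Klein → ZMod 2}
    (h : (twisted e κ D t).WLEquiv (twisted e' κ' D' t')) :
    ∃ π : Equiv.Perm Klein, (∀ i, κ' (π i) = κ i) ∧
      ∀ i j, i ≠ j → (D i j ↔ D' (π i) (π j)) := by
  have hex : ∀ i, ∃ i', κ' i' = κ i := by
    intro i
    obtain ⟨u', hu⟩ := (ColoredGraph.WLEquiv.wlSim h).exists_vertex (e.symm (i, 0))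
    refine ⟨(e' u').1, ?_⟩
    have := color_eq_of_wlType_eq hu
    simpa [twisted] using this.symm
  choose f hf using hex
  have hinj : Function.Injective f := by
    intro i j hij
    refine hκ ?_
    rw [← hf, ← hf, hij]
  refine ⟨Equiv.ofBijective f (Finite.injective_iff_bijective.mp hinj), hf, fun i j hij => ?_⟩
  exact ⟨digraph_of_wlEquiv hκ' h hij (hinj.ne hij) (hf i) (hf j),
    digraph_of_wlEquiv hκ h.symm (hinj.ne hij) hij (hf i).symm (hf j).symm⟩

end VertexColoredGraph

/-! ### Counting the graphs and their 2-WL classes -/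

open DigraphCount

theorem exists_perm_extending {C : Type*} {κ κ' : Klein → C} (hκ : Function.Injective κ)
    (hκ' : Function.Injective κ') : ∃ σ : Equiv.Perm C, ∀ i, σ (κ i) = κ' i := by
  have b : Klein ≃ Fin 4 := Fintype.equivFinOfCardEq rfl
  have := Equiv.Perm.isMultiplyPretransitive C 4
  obtain ⟨σ, hσ⟩ := MulAction.exists_smul_eq (M := Equiv.Perm C)
    (b.symm.toEmbedding.trans ⟨κ, hκ⟩) (b.symm.toEmbedding.trans ⟨κ', hκ'⟩)
  refine ⟨σ, fun i => ?_⟩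
  have := DFunLike.congr_fun hσ (b i)
  simpa using this

theorem exists_injective_of_four_le {C : Type*} (h : 4 ≤ ENat.card C) :
    ∃ κ : Klein → C, Function.Injective κ := by
  have b : Klein ≃ Fin 4 := Fintype.equivFinOfCardEq rfl
  rcases finite_or_infinite C with hC | hC
  · have := Fintype.ofFinite C
    rw [ENat.card_eq_coe_fintype_card] at h
    obtain ⟨f⟩ := Function.Embedding.nonempty_of_card_le (α := Klein) (β := C)
      (by exact_mod_cast h)
    exact ⟨f, f.injective⟩
  · exact ⟨fun i => Infinite.natEmbedding C (b i), (Infinite.natEmbedding C).injective.comp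
      (Fin.val_injective.comp b.injective)⟩

namespace VertexColoredGraph

variable {V W : Type u} {C : Type v}

theorem colorMultiplicity_twisted [Fintype V] (e : V ≃ Klein × Klein) {κ : Klein → C}
    (hκ : Function.Injective κ) (D : Klein → Klein → Prop) (t : Sym2 Klein → ZMod 2) :
    (twisted e κ D t).colorMultiplicity = 4 := by
  have key : ∀ v, Set.ncard {w : V | (twisted e κ D t).color w = (twisted e κ D t).color v} = 4 := by
    intro v
    have h : {w : V | (twisted e κ D t).color w = (twisted e κ D t).color v} =
        Set.range fun x : Klein => e.symm ((e v).1, x) := by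
      ext w
      constructor
      · intro hw
        refine ⟨(e w).2, ?_⟩
        rw [← show (e w).1 = (e v).1 from hκ hw]
        exact e.symm_apply_apply w
      · rintro ⟨x, rfl⟩
        simp [twisted]
    rw [h, Set.ncard_range_of_injective fun x y hxy => congrArg Prod.snd (e.symm.injective hxy),
      Nat.card_eq_fintype_card]
    rfl
  rw [colorMultiplicity, funext key]
  exact Finset.sup_const ⟨e.symm 0, Finset.mem_univ _⟩ 4

/-- Makes the classification of non-amenable graphs applicable to every graph in a 2-WL class. -/
theorem WLEquiv.colorMultiplicity_le [Fintype V] [Fintype W] {G : VertexColoredGraph V C}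
    {H : VertexColoredGraph W C} (h : G.WLEquiv H) :
    H.colorMultiplicity ≤ G.colorMultiplicity := by
  have hsim := ColoredGraph.WLEquiv.wlSim h
  refine Finset.sup_le fun u' _ => ?_
  obtain ⟨u, hu⟩ := hsim.symm.exists_vertex u'
  obtain ⟨β, hβ⟩ := hsim.exists_equiv hu.symm
  have hcol : ∀ w, H.color (β w) = G.color w := fun w =>
    (color_eq_of_wlType_eq (hsim.right (hβ w).1.symm)).symm
  have hset : {w | H.color w = H.color u'} = β '' {w | G.color w = G.color u} := by
    ext w
    obtain ⟨w, rfl⟩ := β.surjective w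
    rw [β.injective.mem_set_image, Set.mem_ofPred_eq, Set.mem_ofPred_eq, hcol,
      color_eq_of_wlType_eq hu.symm]
  rw [hset, Set.ncard_image_of_injective _ β.injective]
  exact Finset.le_sup (f := fun v : V => Set.ncard {w : V | G.color w = G.color v})
    (Finset.mem_univ u)

theorem HasNontrivialWLClass.not_amenable [Fintype V] {G : VertexColoredGraph V C}
    (h : G.HasNontrivialWLClass) : ¬ G.Amenable := by
  obtain ⟨H, hGH, hn⟩ := h
  exact fun ha => hn (toColoredGraph_isomorphic.mp (ha V H.toColoredGraph hGH))

theorem exists_eq_twist [Fintype V] {G : VertexColoredGraph V C} (hV : Fintype.card V ≤ 16)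
    (hm : G.colorMultiplicity ≤ 4) (hG : ¬ G.Amenable) :
    Fintype.card V = 16 ∧ ∃ e κ D ε, Function.Injective κ ∧ G = twisted e κ D (twist ε) := by
  simp only [Amenable, ColoredGraph.Amenable] at hG
  push Not at hG
  obtain ⟨W, _, H, hGH, hn⟩ := hG
  obtain ⟨h16, e, κ, D, t, hκ, rfl⟩ := exists_eq_twisted hV hm hGH hn
  obtain ⟨e', ε, h⟩ := exists_twisted_eq_twist e κ D t
  exact ⟨h16, e', κ, D, ε, hκ, h⟩

theorem not_isomorphic_twisted {e e' : V ≃ Klein × Klein} {κ κ' : Klein → C}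
    (hκ : Function.Injective κ) (hκ' : Function.Injective κ') {D D' : Klein → Klein → Prop}
    {ε ε' : ZMod 2} (σ : Equiv.Perm C) (hε : ε ≠ ε') :
    ¬ ((twisted e κ D (twist ε)).rename σ).Isomorphic (twisted e' κ' D' (twist ε')) := by
  intro h
  have h1 : ε = 0 ↔ ε' = 0 := by
    rw [← hasRainbowClique_twisted (e := e) (D := D) hκ,
      ← hasRainbowClique_twisted (e := e') (D := D') hκ', ← hasRainbowClique_rename (σ := σ)]
    exact ⟨h.hasRainbowClique, (Isomorphic.symm h).hasRainbowClique⟩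
  refine hε ?_
  clear * - h1
  revert ε ε'; decide

theorem hasNontrivialWLClass_twisted [Fintype V] (e : V ≃ Klein × Klein) {κ : Klein → C}
    (hκ : Function.Injective κ) (D : Klein → Klein → Prop) (ε : ZMod 2) :
    (twisted e κ D (twist ε)).HasNontrivialWLClass :=
  ⟨twisted e κ D (twist (ε + 1)), twisted_wlEquiv_twist e κ D ε (ε + 1),
    not_isomorphic_twisted hκ hκ 1 (by revert ε; decide)⟩

/-- The renaming absorbs the permutation of the fibers, so only the digraph class and the bit
remain. -/
theorem isoRename_twisted (e e' : V ≃ Klein × Klein) {κ κ' : Klein → C}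
    (hκ : Function.Injective κ) (hκ' : Function.Injective κ') {D D' : Klein → Klein → Prop}
    (hD : (digraphSetoid Klein).r D D') (ε : ZMod 2) :
    ∃ σ : Equiv.Perm C, ((twisted e κ D (twist ε)).rename σ).Isomorphic
      (twisted e' κ' D' (twist ε)) := by
  obtain ⟨π, hπ⟩ := hD
  obtain ⟨σ, hσ⟩ := exists_perm_extending hκ (hκ'.comp π.injective)
  exact ⟨σ, twisted_twist_isomorphic (κ := σ ∘ κ) e e' hκ' ε π (fun i => (hσ i).symm) hπ⟩

theorem digraph_rel_of_wlEquiv_rename [Fintype V] {e e' : V ≃ Klein × Klein} {κ κ' : Klein → C}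
    (hκ : Function.Injective κ) (hκ' : Function.Injective κ') {D D' : Klein → Klein → Prop}
    {t t' : Sym2 Klein → ZMod 2} {σ : Equiv.Perm C}
    (h : ((twisted e κ D t).rename σ).WLEquiv (twisted e' κ' D' t')) :
    (digraphSetoid Klein).r D D' := by
  obtain ⟨π, -, hπ⟩ := exists_perm_of_wlEquiv (κ := σ ∘ κ) (e := e) (D := D) (t := t)
    (σ.injective.comp hκ) hκ' h
  exact ⟨π, hπ⟩

/-- With coordinates and colors fixed, the pairs of a digraph class and a bit parametrize the
classes: 2-WL recovers the digraph class, rainbow cliques the bit. -/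
theorem ncard_isoRename_classes [Fintype V] (hV : Fintype.card V = 16) (e : V ≃ Klein × Klein)
    {κ : Klein → C} (hκ : Function.Injective κ) :
    (Quotient.mk (isoRenameSetoid V C) ''
      {G | G.colorMultiplicity = 4 ∧ ¬ G.Amenable}).ncard = 436 := by
  have himage : Quotient.mk (isoRenameSetoid V C) ''
      {G | G.colorMultiplicity = 4 ∧ ¬ G.Amenable} =
      Set.range fun p : Quotient (digraphSetoid Klein) × ZMod 2 =>
        Quotient.mk (isoRenameSetoid V C) (twisted e κ p.1.out (twist p.2)) := by
    ext Q
    constructor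
    · rintro ⟨G, ⟨hm, hG⟩, rfl⟩
      obtain ⟨-, e', κ', D, ε, hκ', rfl⟩ := exists_eq_twist hV.le hm.le hG
      refine ⟨(Quotient.mk _ D, ε), Quotient.sound ?_⟩
      exact isoRename_twisted e e' hκ hκ' (Quotient.mk_out (s := digraphSetoid Klein) D) ε
    · rintro ⟨⟨q, ε⟩, rfl⟩
      exact ⟨_, ⟨colorMultiplicity_twisted e hκ _ _,
        (hasNontrivialWLClass_twisted e hκ _ _).not_amenable⟩, rfl⟩
  rw [himage, Set.ncard_range_of_injective, Nat.card_prod, card_digraphs Klein rfl,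
    Nat.card_eq_fintype_card]
  · rfl
  · rintro ⟨q, ε⟩ ⟨q', ε'⟩ h
    obtain ⟨σ, hσ⟩ := Quotient.exact h
    refine Prod.ext ?_ (by_contra fun hε => not_isomorphic_twisted hκ hκ σ hε hσ)
    have h1 := digraph_rel_of_wlEquiv_rename hκ hκ (Isomorphic.wlEquiv hσ)
    have h2 := Quotient.sound (s := digraphSetoid Klein) h1
    rwa [Quotient.out_eq, Quotient.out_eq] at h2

theorem ncard_wlRename_classes [Fintype V] (hV : Fintype.card V = 16) (e : V ≃ Klein × Klein)
    {κ : Klein → C} (hκ : Function.Injective κ) :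
    (Quotient.mk (wlRenameSetoid V C) ''
      {G | G.colorMultiplicity = 4 ∧ G.HasNontrivialWLClass}).ncard = 218 := by
  have himage : Quotient.mk (wlRenameSetoid V C) ''
      {G | G.colorMultiplicity = 4 ∧ G.HasNontrivialWLClass} =
      Set.range fun q : Quotient (digraphSetoid Klein) =>
        Quotient.mk (wlRenameSetoid V C) (twisted e κ q.out (twist 0)) := by
    ext Q
    constructor
    · rintro ⟨G, ⟨hm, hG⟩, rfl⟩
      obtain ⟨-, e', κ', D, ε, hκ', rfl⟩ := exists_eq_twist hV.le hm.le hG.not_amenable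
      refine ⟨Quotient.mk _ D, Quotient.sound ?_⟩
      obtain ⟨σ, hσ⟩ := isoRename_twisted e e' hκ hκ'
        (Quotient.mk_out (s := digraphSetoid Klein) D) 0
      exact ⟨σ, (Isomorphic.wlEquiv hσ).trans (twisted_wlEquiv_twist e' κ' D 0 ε)⟩
    · rintro ⟨q, rfl⟩
      exact ⟨_, ⟨colorMultiplicity_twisted e hκ _ _, hasNontrivialWLClass_twisted e hκ _ _⟩, rfl⟩
  rw [himage, Set.ncard_range_of_injective, card_digraphs Klein rfl]
  intro q q' h
  obtain ⟨σ, hσ⟩ := Quotient.exact h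
  have h2 := Quotient.sound (s := digraphSetoid Klein) (digraph_rel_of_wlEquiv_rename hκ hκ hσ)
  rwa [Quotient.out_eq, Quotient.out_eq] at h2

/-- The graphs that are 2-WL-equivalent to a twisted graph. -/
theorem exists_isomorphic_of_wlEquiv_twisted [Fintype V] (hV : Fintype.card V = 16)
    {e : V ≃ Klein × Klein} {κ : Klein → C} (hκ : Function.Injective κ)
    {D : Klein → Klein → Prop} {ε : ZMod 2} {H : VertexColoredGraph V C}
    (h : (twisted e κ D (twist ε)).WLEquiv H) :
    ∃ ε', H.Isomorphic (twisted e κ D (twist ε')) := by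
  have hm : H.colorMultiplicity ≤ 4 :=
    h.colorMultiplicity_le.trans (colorMultiplicity_twisted e hκ D _).le
  have hH : ¬ H.Amenable := by
    -- `H` cannot be isomorphic to both twists, so the class of `H` contains a graph not isomorphic
    -- to `H`.
    refine HasNontrivialWLClass.not_amenable ?_
    by_cases hiso : H.Isomorphic (twisted e κ D (twist ε))
    · refine ⟨twisted e κ D (twist (ε + 1)), h.symm.trans (twisted_wlEquiv_twist e κ D _ _),
        fun h' => ?_⟩
      exact not_isomorphic_twisted hκ hκ 1 (show ε ≠ ε + 1 by clear * -; revert ε; decide)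
        (hiso.symm.trans h')
    · exact ⟨_, h.symm, hiso⟩
  obtain ⟨-, e', κ', D', ε', hκ', rfl⟩ := exists_eq_twist hV.le hm hH
  obtain ⟨π, hπ, hD⟩ := exists_perm_of_wlEquiv hκ hκ' h
  exact ⟨ε', (twisted_twist_isomorphic e e' hκ' ε' π hπ hD).symm⟩

theorem ncard_classes_of_wlEquiv [Fintype V] (hV : Fintype.card V = 16)
    {G : VertexColoredGraph V C} (hm : G.colorMultiplicity = 4) (hG : G.HasNontrivialWLClass) :
    (Quotient.mk (isoSetoid V C) '' {H | G.WLEquiv H}).ncard = 2 ∧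
      (Quotient.mk (isoRenameSetoid V C) ''
        {H | ∃ σ : Equiv.Perm C, (G.rename σ).WLEquiv H}).ncard = 2 := by
  obtain ⟨-, e, κ, D, ε, hκ, rfl⟩ := exists_eq_twist hV.le hm.le hG.not_amenable
  have two : ∀ ε' : ZMod 2, ε' = 0 ∨ ε' = 1 := by decide
  have hne : (0 : ZMod 2) ≠ 1 := by decide
  constructor
  · have h : Quotient.mk (isoSetoid V C) '' {H | (twisted e κ D (twist ε)).WLEquiv H} =
        {Quotient.mk _ (twisted e κ D (twist 0)), Quotient.mk _ (twisted e κ D (twist 1))} := by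
      ext Q
      constructor
      · rintro ⟨H, hH, rfl⟩
        obtain ⟨ε', hε'⟩ := exists_isomorphic_of_wlEquiv_twisted hV hκ hH
        rcases two ε' with rfl | rfl
        exacts [Or.inl (Quotient.sound hε'), Or.inr (Quotient.sound hε')]
      · rintro (rfl | rfl)
        exacts [⟨_, twisted_wlEquiv_twist e κ D _ _, rfl⟩,
          ⟨_, twisted_wlEquiv_twist e κ D _ _, rfl⟩]
    rw [h, Set.ncard_pair]
    exact fun h => not_isomorphic_twisted hκ hκ 1 hne (Quotient.exact h)
  · have h : Quotient.mk (isoRenameSetoid V C) ''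
        {H | ∃ σ : Equiv.Perm C, ((twisted e κ D (twist ε)).rename σ).WLEquiv H} =
        {Quotient.mk _ (twisted e κ D (twist 0)), Quotient.mk _ (twisted e κ D (twist 1))} := by
      ext Q
      constructor
      · rintro ⟨H, ⟨σ, hH⟩, rfl⟩
        obtain ⟨ε', hε'⟩ := exists_isomorphic_of_wlEquiv_twisted (κ := σ ∘ κ) (e := e) (D := D)
          (ε := ε) hV (σ.injective.comp hκ) hH
        have hrel : ∃ τ : Equiv.Perm C,
            ((twisted e κ D (twist ε')).rename τ).Isomorphic H := ⟨σ, hε'.symm⟩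
        have hmk := (Quotient.sound (s := isoRenameSetoid V C) hrel).symm
        rcases two ε' with rfl | rfl
        exacts [Or.inl hmk, Or.inr hmk]
      · rintro (rfl | rfl)
        exacts [⟨_, ⟨1, twisted_wlEquiv_twist e κ D _ _⟩, rfl⟩,
          ⟨_, ⟨1, twisted_wlEquiv_twist e κ D _ _⟩, rfl⟩]
    rw [h, Set.ncard_pair]
    intro h
    obtain ⟨σ, hσ⟩ := Quotient.exact h
    exact not_isomorphic_twisted hκ hκ σ hne hσ

end VertexColoredGraph

theorem mainTheorem12 :
    (∀ (V : Type u) (C : Type v) [Fintype V] (G : VertexColoredGraph V C),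
      Fintype.card V ≤ 15 → G.colorMultiplicity = 4 → G.Amenable) ∧
    (∀ (V : Type u) (C : Type v) [Fintype V], Fintype.card V = 16 → 4 ≤ ENat.card C →
      -- the number of non-amenable graphs up to isomorphism and color renaming
      (Quotient.mk (VertexColoredGraph.isoRenameSetoid V C) ''
        {G | G.colorMultiplicity = 4 ∧ ¬ G.Amenable}).ncard = 436 ∧
      -- the number of non-trivial 2-WL classes up to color renaming
      (Quotient.mk (VertexColoredGraph.wlRenameSetoid V C) ''
        {G | G.colorMultiplicity = 4 ∧ G.HasNontrivialWLClass}).ncard = 218 ∧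
      -- each of them consists of exactly two graphs, up to isomorphism, and also
      -- up to isomorphism and color renaming if colors may be renamed
      (∀ G : VertexColoredGraph V C, G.colorMultiplicity = 4 → G.HasNontrivialWLClass →
        (Quotient.mk (VertexColoredGraph.isoSetoid V C) '' {H | G.WLEquiv H}).ncard = 2 ∧
        (Quotient.mk (VertexColoredGraph.isoRenameSetoid V C) ''
          {H | ∃ σ : Equiv.Perm C, (G.rename σ).WLEquiv H}).ncard = 2)) := by
  refine ⟨fun V C _ G hV hm => ?_, fun V C _ hV hC => ?_⟩
  · by_contra hG
    obtain ⟨h16, -⟩ := VertexColoredGraph.exists_eq_twist (hV.trans (by norm_num)) hm.le hG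
    omega
  · obtain ⟨κ, hκ⟩ := exists_injective_of_four_le hC
    have e : V ≃ Klein × Klein := Fintype.equivOfCardEq (hV.trans rfl)
    exact ⟨VertexColoredGraph.ncard_isoRename_classes hV e hκ,
      VertexColoredGraph.ncard_wlRename_classes hV e hκ,
      fun G hm hG => VertexColoredGraph.ncard_classes_of_wlEquiv hV hm hG⟩
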